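/- Let $L,R,\mu>0$, $\mathcal I=(0,L)$, $Q_T=(0,T)\times\mathcal I$, and let $f_0,g_0\in H^1(\mathcal I)$ be non-negative. For $\varepsilon\in(0,1]$ put $a_\varepsilon(s)=\varepsilon+\max\{0,s\}$ and $$\mathcal E(u,v)=\tfrac12\int_{\mathcal I}|\partial_xu|^2+R|\partial_x(u+v)|^2\,dx .$$ For a pair $(f,g)$ put $$H_f^\varepsilon=a_\varepsilon^3(f)\partial_x^3f+\tfrac R2\big(2a_\varepsilon^3(f)+3a_\varepsilon^2(f)a_\varepsilon(g)\big)\partial_x^3(f+g),$$ $$H_g^\varepsilon=\tfrac32a_\varepsilon^2(f)a_\varepsilon(g)\partial_x^3f+\tfrac R2\big(2\mu a_\varepsilon^3(g)+3a_\varepsilon^2(f)a_\varepsilon(g)+6a_\varepsilon(f)a_\varepsilon^2(g)\big)\partial_x^3(f+g).$$ Call $(f,g)$ an $\varepsilon$-regularized solution (with initial data $(f_0,g_0)$) if the following hold. * For all $T>0$, $f,g\in L_\infty(0,T;H^1(\mathcal I))\cap L_2(0,T;H^3(\mathcal I))\cap\bigcap_{\alpha\in[0,1/2)}C([0,T],C^\alpha(\overline{\mathcal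 I}))$ and $\partial_tf,\partial_tg\in L_2(0,T;(H^1(\mathcal I))')$. * For all $T>0$ and all $\xi\in L_2(0,T;H^1(\mathcal I))$, $\int_0^T\langle\partial_tf\,|\,\xi\rangle\,dt=\int_{Q_T}H_f^\varepsilon\,\partial_x\xi\,dx\,dt$ and $\int_0^T\langle\partial_tg\,|\,\xi\rangle\,dt=\int_{Q_T}H_g^\varepsilon\,\partial_x\xi\,dx\,dt$. * $(f,g)(0)=(f_0,g_0)$; for all $T\ge0$, $\int_{\mathcal I}f(T)\,dx=\|f_0\|_{L_1}$ and $\int_{\mathcal I}g(T)\,dx=\|g_0\|_{L_1}$; and $\partial_xf(T)=\partial_xg(T)=0$ at $x=0,L$ for almost all $T>0$. * For almost all $T>0$, $$\begin{aligned}\mathcal E(f(T),g(T))&+\int_{Q_T}a_\varepsilon(f)\Big|a_\varepsilon(f)\partial_x^3f+\tfrac R2\big(2a_\varepsilon(f)+3a_\varepsilon(g)\big)\partial_x^3(f+g)\Big|^2dx\,dt\\&+\mu R^2\int_{Q_T}a_\varepsilon^3(g)|\partial_x^3(f+g)|^2dx\,dt+\tfrac{3R^2}4\int_{Q_T}a_\varepsilon(f)a_\varepsilon^2(g)|\partial_x^3(f+g)|^2dx\,dt\le\mathcal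 E(f_0,g_0).\end{aligned}$$ Let $\varphi\in C^\infty(\mathbb R)$ be non-negative with support in $[-1,0]$ and $\int_{\mathbb R}\varphi\,dx=1$, and put $\chi_1(x)=-\int_0^x\int_s^\infty\varphi(\tau)\,d\tau\,ds$ and $\chi_\delta(x)=\delta\chi_1(x/\delta)$ for $\delta>0$. (i) There is a constant $C$, depending only on $L,R,\mu,\varphi,f_0,g_0$, such that for every $\varepsilon\in(0,1]$, every $\varepsilon$-regularized solution $(f_\varepsilon,g_\varepsilon)$ and every $T\ge0$, $$\Big|\int_{\mathcal I}\chi_{\sqrt\varepsilon}(f_\varepsilon(T))\,dx\Big|\le C\sqrt T\,\varepsilon\qquad\text{and}\qquad\Big|\int_{\mathcal I}\chi_{\sqrt\varepsilon}(g_\varepsilon(T))\,dx\Big|\le C\sqrt{T\varepsilon}.$$ (ii) Let $T>0$, let $(\varepsilon_k)_k\subset(0,1]$ with $\varepsilon_k\to0$, let $(f_{\varepsilon_k},g_{\varepsilon_k})$ be $\varepsilon_k$-regularized solutions, and let $(f,g)\in C(\overline{Q_T},\mathbb R^2)$ be such that $(f_{\varepsilon_k},g_{\varepsilon_k})\to(f,g)$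 uniformly on $\overline{Q_T}$. Then $f\ge0$ and $g\ge0$ on $\overline{Q_T}$. -/

import Mathlib

open MeasureTheory Set Filter Topology
open scoped ContDiff ENNReal

noncomputable section

namespace ThinFilm

/-- Lebesgue measure on the interval `(0, L)`. -/
abbrev vol (L : ℝ) : Measure ℝ := volume.restrict (Ioo 0 L)

/-- `v` is the weak derivative of `u` on `(0, L)`. -/
def IsWeakDeriv (L : ℝ) (u v : ℝ → ℝ) : Prop :=
  ∀ ψ : ℝ → ℝ, ContDiff ℝ ∞ ψ → HasCompactSupport ψ → tsupport ψ ⊆ Ioo 0 L →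
    ∫ x in Ioo 0 L, u x * deriv ψ x = -∫ x in Ioo 0 L, v x * ψ x

lemma integrable_mul_test {L : ℝ} (u : Lp ℝ 2 (vol L)) {ψ : ℝ → ℝ}
    (hψ : Continuous ψ) (hc : HasCompactSupport ψ) :
    Integrable (fun x => u x * ψ x) (vol L) :=
  MemLp.integrable_mul (p := 2) (q := 2) (Lp.memLp u) (hψ.memLp_of_hasCompactSupport hc)

/-- The Sobolev space `H^k(0, L)`. An element is the tuple `(u, u', …, u^(k))` of a function
`u ∈ L²(0, L)` and its weak derivatives, which all lie in `L²(0, L)`; the norm is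
`(∑ j ≤ k, ‖u^(j)‖²)^(1/2)`. -/
def H (L : ℝ) (k : ℕ) : Submodule ℝ (PiLp 2 (fun _ : Fin (k + 1) => Lp ℝ 2 (vol L))) where
  carrier := {u | ∀ j : Fin k, IsWeakDeriv L (u j.castSucc) (u j.succ)}
  zero_mem' := by
    intro j ψ _ _ _
    have h0 : (((0 : Lp ℝ 2 (vol L)) : Lp ℝ 2 (vol L)) : ℝ → ℝ) =ᵐ[vol L] 0 :=
      Lp.coeFn_zero ℝ 2 (vol L)
    have h1 : ∀ θ : ℝ → ℝ, ∫ x in Ioo 0 L, (0 : Lp ℝ 2 (vol L)) x * θ x = 0 := by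
      intro θ
      apply integral_eq_zero_of_ae
      filter_upwards [h0] with x hx
      simp only [hx, Pi.zero_apply, zero_mul]
    simp only [PiLp.zero_apply]
    rw [h1, h1, neg_zero]
  add_mem' := by
    intro u v hu hv j ψ hψ hc hs
    have key : ∀ (a b : Lp ℝ 2 (vol L)) (θ : ℝ → ℝ), Continuous θ → HasCompactSupport θ →
        ∫ x in Ioo 0 L, (a + b : Lp ℝ 2 (vol L)) x * θ x
          = (∫ x in Ioo 0 L, a x * θ x) + ∫ x in Ioo 0 L, b x * θ x := by
      intro a b θ hθ hθc
      rw [← integral_add (integrable_mul_test a hθ hθc) (integrable_mul_test b hθ hθc)]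
      apply integral_congr_ae
      filter_upwards [Lp.coeFn_add a b] with x hx
      rw [hx, Pi.add_apply, add_mul]
    simp only [PiLp.add_apply]
    rw [key _ _ _ (hψ.continuous_deriv (by simp)) hc.deriv, key _ _ _ hψ.continuous hc,
      hu j ψ hψ hc hs, hv j ψ hψ hc hs]
    ring
  smul_mem' := by
    intro c u hu j ψ hψ hc hs
    have key : ∀ (a : Lp ℝ 2 (vol L)) (θ : ℝ → ℝ),
        ∫ x in Ioo 0 L, (c • a : Lp ℝ 2 (vol L)) x * θ x
          = c * ∫ x in Ioo 0 L, a x * θ x := by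
      intro a θ
      rw [← integral_const_mul]
      apply integral_congr_ae
      filter_upwards [Lp.coeFn_smul c a] with x hx
      rw [hx, Pi.smul_apply, smul_eq_mul, mul_assoc]
    simp only [PiLp.smul_apply]
    rw [key, key, hu j ψ hψ hc hs]
    ring

lemma weakDeriv_unique {L : ℝ} (u u' v v' : Lp ℝ 2 (vol L)) (h : IsWeakDeriv L u v)
    (h' : IsWeakDeriv L u' v') (huu : u = u') : v = v' := by
  subst huu
  have hint : ∀ w : Lp ℝ 2 (vol L), Integrable w (vol L) := fun w =>
    (Lp.memLp w).integrable (by norm_num)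
  have := isOpen_Ioo.ae_eq_zero_of_integral_contDiff_smul_eq_zero (U := Ioo 0 L)
    (f := fun x => v x - v' x) (μ := vol L)
    (((hint v).sub (hint v')).locallyIntegrable.locallyIntegrableOn _) (by
      intro g hg hc hs
      have e1 := h g hg hc hs
      have e2 := h' g hg hc hs
      have : ∫ x, g x • (v x - v' x) ∂vol L
          = (∫ x, v x * g x ∂vol L) - ∫ x, v' x * g x ∂vol L := by
        rw [← integral_sub (integrable_mul_test v hg.continuous hc)
          (integrable_mul_test v' hg.continuous hc)]
        congr 1; ext x; simp; ring
      rw [this]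
      have : -∫ x, v x * g x ∂vol L = -∫ x, v' x * g x ∂vol L := by rw [← e1, ← e2]
      linarith)
  apply Lp.ext
  filter_upwards [this, ae_restrict_mem measurableSet_Ioo] with x h1 h2
  linarith [h1 h2]

lemma jet_unique {L : ℝ} {k : ℕ} (u v : H L k) (h : u.1 0 = v.1 0) : u = v := by
  have : ∀ j : ℕ, ∀ hj : j < k + 1, u.1 ⟨j, hj⟩ = v.1 ⟨j, hj⟩ := by
    intro j
    induction j with
    | zero => intro _; exact h
    | succ n ih =>
      intro hj
      exact weakDeriv_unique _ _ _ _ (u.2 ⟨n, by omega⟩) (v.2 ⟨n, by omega⟩) (ih (by omega))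
  apply Subtype.ext
  ext1
  exact this _ _

/-- `u ∈ H^k(0, L)` is the class of the function `w`. -/
def Represents {L : ℝ} {k : ℕ} (u : H L k) (w : ℝ → ℝ) : Prop :=
  (u.1 0 : ℝ → ℝ) =ᵐ[vol L] w

/-- The function `w` belongs to `H^k(0, L)`. -/
def MemH (L : ℝ) (k : ℕ) (w : ℝ → ℝ) : Prop := ∃ u : H L k, Represents u w

open Classical in
/-- The `k`-th weak derivative of a function `w ∈ H^k(0, L)` (unique almost everywhere);
zero if `w ∉ H^k(0, L)`. -/
def D (L : ℝ) (k : ℕ) (w : ℝ → ℝ) : ℝ → ℝ :=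
  if h : MemH L k w then (h.choose.1 (Fin.last k) : ℝ → ℝ) else 0

/-- `D L k w` is well defined: it is the last entry of every tuple that represents `w`. -/
lemma D_eq {L : ℝ} {k : ℕ} (u : H L k) (w : ℝ → ℝ) (h : Represents u w) :
    D L k w = u.1 (Fin.last k) := by
  have hm : MemH L k w := ⟨u, h⟩
  have : hm.choose = u := jet_unique _ _ (Lp.ext (hm.choose_spec.trans h.symm))
  rw [D, dif_pos hm, this]

/-- `f ∈ L_p(0, T; H^k(0, L))` (Bochner space). -/
def MemLpH (L T : ℝ) (p : ℝ≥0∞) (k : ℕ) (f : ℝ → ℝ → ℝ) : Prop :=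
  ∃ u : ℝ → H L k, MemLp u p (vol T) ∧ ∀ᵐ t ∂vol T, Represents (u t) (f t)

/-- `f ∈ C([0, T], C^α([0, L]))`, where `C^α` carries the norm
`sup |w| + sup |w x - w y| / |x - y|^α` and consists of continuous functions. -/
def ContIntoHolder (L T α : ℝ) (f : ℝ → ℝ → ℝ) : Prop :=
  (∀ t ∈ Icc 0 T, ContinuousOn (f t) (Icc 0 L) ∧
    ∃ K : ℝ, ∀ x ∈ Icc 0 L, ∀ y ∈ Icc 0 L, |f t x - f t y| ≤ K * |x - y| ^ α) ∧
  ∀ t ∈ Icc 0 T, ∀ η > 0, ∃ ρ > 0, ∀ s ∈ Icc 0 T, |s - t| < ρ →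
    (∀ x ∈ Icc 0 L, |f s x - f t x| ≤ η) ∧
    ∀ x ∈ Icc 0 L, ∀ y ∈ Icc 0 L, |(f s x - f t x) - (f s y - f t y)| ≤ η * |x - y| ^ α

/-- `ft` is the distributional time derivative of `f` on `(0, T)`, as a function with values in
the dual of `H^1(0, L)`, into which `L²(0, L)` is embedded by the `L²` pairing. -/
def IsTimeDeriv (L T : ℝ) (f : ℝ → ℝ → ℝ) (ft : ℝ → StrongDual ℝ (H L 1)) : Prop :=
  ∀ w : H L 1, ∀ η : ℝ → ℝ, ContDiff ℝ ∞ η → HasCompactSupport η → tsupport η ⊆ Ioo 0 T →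
    ∫ t in Ioo 0 T, deriv η t * ∫ x in Ioo 0 L, f t x * w.1 0 x
      = -∫ t in Ioo 0 T, η t * ft t w

/-- `∂_t f ∈ L₂(0, T; (H^1)')` and `∫_0^T ⟨∂_t f | ξ⟩ dt = ∫_{Q_T} J ∂_x ξ dx dt` for all
`ξ ∈ L₂(0, T; H^1(0, L))`. -/
def WeakEquation (L T : ℝ) (f J : ℝ → ℝ → ℝ) : Prop :=
  ∃ ft : ℝ → StrongDual ℝ (H L 1), MemLp ft 2 (vol T) ∧ IsTimeDeriv L T f ft ∧
    ∀ ξ : ℝ → H L 1, MemLp ξ 2 (vol T) →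
      ∫ t in Ioo 0 T, ft t (ξ t) = ∫ t in Ioo 0 T, ∫ x in Ioo 0 L, J t x * (ξ t).1 1 x

/-- `a_ε(s) = ε + max {0, s}`. -/
def a (ε s : ℝ) : ℝ := ε + max 0 s

/-- The flux in the first regularized equation. -/
def fluxF (L R ε : ℝ) (f g : ℝ → ℝ → ℝ) (t x : ℝ) : ℝ :=
  a ε (f t x) ^ 3 * D L 3 (f t) x
    + R / 2 * (2 * a ε (f t x) ^ 3 + 3 * a ε (f t x) ^ 2 * a ε (g t x))
      * (D L 3 (f t) x + D L 3 (g t) x)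

/-- The flux in the second regularized equation. -/
def fluxG (L R μ ε : ℝ) (f g : ℝ → ℝ → ℝ) (t x : ℝ) : ℝ :=
  3 / 2 * a ε (f t x) ^ 2 * a ε (g t x) * D L 3 (f t) x
    + R / 2 * (2 * μ * a ε (g t x) ^ 3 + 3 * a ε (f t x) ^ 2 * a ε (g t x)
        + 6 * a ε (f t x) * a ε (g t x) ^ 2)
      * (D L 3 (f t) x + D L 3 (g t) x)

/-- The energy `1/2 ∫ |∂_x u|² + R |∂_x (u + v)|² dx`. -/
def energy (L R : ℝ) (u v : ℝ → ℝ) : ℝ :=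
  1 / 2 * ∫ x in Ioo 0 L, (D L 1 u x ^ 2 + R * (D L 1 u x + D L 1 v x) ^ 2)

/-- The dissipation of the energy at time `t` along the regularized system. -/
def dissipation (L R μ ε : ℝ) (f g : ℝ → ℝ → ℝ) (t : ℝ) : ℝ :=
  (∫ x in Ioo 0 L, a ε (f t x) * (a ε (f t x) * D L 3 (f t) x
      + R / 2 * (2 * a ε (f t x) + 3 * a ε (g t x)) * (D L 3 (f t) x + D L 3 (g t) x)) ^ 2)
    + μ * R ^ 2 * (∫ x in Ioo 0 L, a ε (g t x) ^ 3 * (D L 3 (f t) x + D L 3 (g t) x) ^ 2)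
    + 3 * R ^ 2 / 4 * (∫ x in Ioo 0 L, a ε (f t x) * a ε (g t x) ^ 2
      * (D L 3 (f t) x + D L 3 (g t) x) ^ 2)

/-- `w ∈ L_∞(0, T; H^1) ∩ L₂(0, T; H^3) ∩ ⋂_{α ∈ [0, 1/2)} C([0, T], C^α)` for all `T > 0`. -/
structure IsRegular (L : ℝ) (w : ℝ → ℝ → ℝ) : Prop where
  memLinfty : ∀ T > 0, MemLpH L T ∞ 1 w
  memL2 : ∀ T > 0, MemLpH L T 2 3 w
  holder : ∀ T > 0, ∀ α : ℝ, 0 ≤ α → α < 1 / 2 → ContIntoHolder L T α w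

/-- `(f, g)` is a global weak solution of the regularized system with parameter `ε` and initial
data `(f₀, g₀)`. Only the values at `t ≥ 0` and `x ∈ [0, L]` matter. -/
structure IsRegularizedSolution (L R μ ε : ℝ) (f₀ g₀ : ℝ → ℝ) (f g : ℝ → ℝ → ℝ) : Prop where
  regular_f : IsRegular L f
  regular_g : IsRegular L g
  equation_f : ∀ T > 0, WeakEquation L T f (fluxF L R ε f g)
  equation_g : ∀ T > 0, WeakEquation L T g (fluxG L R μ ε f g)
  initial_f : f 0 =ᵐ[vol L] f₀
  initial_g : g 0 =ᵐ[vol L] g₀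
  mass_f : ∀ T ≥ 0, ∫ x in Ioo 0 L, f T x = ∫ x in Ioo 0 L, |f₀ x|
  mass_g : ∀ T ≥ 0, ∫ x in Ioo 0 L, g T x = ∫ x in Ioo 0 L, |g₀ x|
  neumann : ∀ᵐ T ∂volume.restrict (Ioi (0 : ℝ)), ∀ x ∈ ({0, L} : Set ℝ),
    HasDerivWithinAt (f T) 0 (Icc 0 L) x ∧ HasDerivWithinAt (g T) 0 (Icc 0 L) x
  energy_le : ∀ᵐ T ∂volume.restrict (Ioi (0 : ℝ)),
    energy L R (f T) (g T) + ∫ t in Ioo 0 T, dissipation L R μ ε f g t ≤ energy L R f₀ g₀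

/-- `χ_δ(x) = δ χ_1(x / δ)` with `χ_1(x) = -∫_0^x ∫_s^∞ φ(τ) dτ ds`. -/
def chi (φ : ℝ → ℝ) (δ x : ℝ) : ℝ :=
  δ * -∫ s in (0 : ℝ)..(x / δ), ∫ τ in Ioi s, φ τ

end ThinFilm

end

/-! Formally, testing the equation for a component `h` with `χ_δ'(h)` gives `d/dt ∫ χ_δ(h) = ∫ J
χ_δ''(h) ∂ₓh`. The weight `χ_δ''(h) = φ(h/δ)/δ` is at most `K/δ` and lives where `h ≤ 0`. There
`a_ε(h) = ε`, so the degenerate mobility makes the flux small relative to the dissipation density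
`p`: `J² ≤ ε³ p` for `f`, and `J² ≤ ε² B² p` for `g`, where `B` comes from a sup bound on `f` (mass
plus energy). Cauchy–Schwarz in `x`, using the energy bound on `∂ₓh`, then in `t`, using the bound
on the total dissipation, yields the orders `ε^{3/2}/√ε = ε` and `ε/√ε = √ε` for `δ = √ε`. The
factor `√T` comes from the second Cauchy–Schwarz.

The chain rule in time is avoided. On a short interval `[t₁, t₂]` the test function is frozen at
`χ_δ'(h(t₂))`, and convexity of `χ_δ` bounds the increment of `∫ χ_δ(h)` (`integral_chi_sub_le`).
The price is that the flux is evaluated at times `s` other than `t₂`. By uniform continuity `h(s) ≤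
η` wherever `h(t₂) ≤ 0`, so the flux bounds are needed with `ε + η` in place of `ε` (`fluxF_sq_le`,
`fluxG_sq_le`). Short intervals are chained in `integral_chi_final_sub_le`, and `η → 0` in
`integral_chi_le_of_flux_le`.

For the limit, `χ_δ(y) ≥ max(-y - δ, 0)`: vanishing of `∫ χ_δ` as `δ → 0` forces the integral of the
negative part of the uniform limit to vanish, and continuity gives non-negativity everywhere. -/

namespace ThinFilm

/-! ### One-dimensional Sobolev functions: primitives, du Bois-Reymond, chain rule. -/

/-- A primitive of a test function with vanishing integral is a test function. -/
lemma exists_test_primitive {L : ℝ} (hL : 0 < L) {θ : ℝ → ℝ} (hθ : ContDiff ℝ ∞ θ)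
    (hc : HasCompactSupport θ) (hs : tsupport θ ⊆ Ioo 0 L) (h0 : ∫ x in (0 : ℝ)..L, θ x = 0) :
    ∃ ψ : ℝ → ℝ, ContDiff ℝ ∞ ψ ∧ HasCompactSupport ψ ∧ tsupport ψ ⊆ Ioo 0 L ∧
      deriv ψ = θ := by
  obtain ⟨a, b, ha, hb, hsab⟩ : ∃ a b, 0 < a ∧ b < L ∧ tsupport θ ⊆ Icc a b := by
    rcases (tsupport θ).eq_empty_or_nonempty with he | hne
    · exact ⟨L / 2, L / 2, by linarith, by linarith, by simp [he]⟩
    · obtain ⟨a, ha, ha'⟩ := hc.isCompact.exists_isLeast hne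
      obtain ⟨b, hb, hb'⟩ := hc.isCompact.exists_isGreatest hne
      exact ⟨a, b, (hs ha).1, (hs hb).2, fun x hx => ⟨ha' hx, hb' hx⟩⟩
  have hz : ∀ x, x ∉ Icc a b → θ x = 0 := fun x hx =>
    image_eq_zero_of_notMem_tsupport fun h => hx (hsab h)
  have hd : ∀ x, HasDerivAt (fun x => ∫ s in (0 : ℝ)..x, θ s) (θ x) x := fun x =>
    intervalIntegral.integral_hasDerivAt_right (hθ.continuous.intervalIntegrable _ _)
      (hθ.continuous.stronglyMeasurableAtFilter _ _) hθ.continuous.continuousAt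
  have hde : deriv (fun x => ∫ s in (0 : ℝ)..x, θ s) = θ := funext fun x => (hd x).deriv
  have hsupp : Function.support (fun x => ∫ s in (0 : ℝ)..x, θ s) ⊆ Icc a b := by
    intro x hx
    by_contra hxab
    apply hx
    rcases lt_or_ge x a with h | h
    · refine (intervalIntegral.integral_congr (g := fun _ => (0 : ℝ)) fun s hsm => ?_).trans
        (by simp)
      refine hz s fun h' => ?_
      rcases mem_uIcc.1 hsm with h'' | h'' <;> linarith [h'.1, h''.2]
    · have hxb : b < x := not_le.1 fun h' => hxab ⟨h, h'⟩
      -- To the right of the support, the primitive is minus the remaining integral up to `L`,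
      -- because the total integral vanishes.
      have e : ∫ s in x..L, θ s = 0 := by
        refine (intervalIntegral.integral_congr (g := fun _ => (0 : ℝ)) fun s hsm => ?_).trans
          (by simp)
        refine hz s fun h' => ?_
        rcases mem_uIcc.1 hsm with h'' | h'' <;> linarith [h'.2, h''.1]
      have := intervalIntegral.integral_add_adjacent_intervals
        (hθ.continuous.intervalIntegrable (μ := volume) 0 x)
        (hθ.continuous.intervalIntegrable x L)
      simp only
      linarith
  have hts : tsupport (fun x => ∫ s in (0 : ℝ)..x, θ s) ⊆ Icc a b :=
    closure_minimal hsupp isClosed_Icc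
  refine ⟨_, ?_, HasCompactSupport.of_support_subset_isCompact isCompact_Icc hsupp,
    hts.trans (Icc_subset_Ioo ha hb), hde⟩
  rw [contDiff_infty_iff_deriv, hde]
  exact ⟨fun x => (hd x).differentiableAt, hθ⟩

/-- The almost everywhere derivative of an absolutely continuous function is a weak
derivative. -/
lemma isWeakDeriv_of_absolutelyContinuous {L : ℝ} (hL : 0 < L) {W v : ℝ → ℝ}
    (hW : AbsolutelyContinuousOnInterval W 0 L) (hv : ∀ᵐ x ∂vol L, deriv W x = v x) :
    IsWeakDeriv L W v := by
  intro ψ hψ hc hs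
  have hz : ∀ x, x ∉ Ioo 0 L → ψ x = 0 := fun x hx =>
    image_eq_zero_of_notMem_tsupport fun h => hx (hs h)
  have hψac : AbsolutelyContinuousOnInterval ψ 0 L :=
    (hψ.of_le (by simp)).contDiffOn.absolutelyContinuousOnInterval
  have := hW.integral_mul_deriv_eq_deriv_mul hψac
  rw [hz 0 (by simp), hz L (by simp), intervalIntegral.integral_of_le hL.le,
    intervalIntegral.integral_of_le hL.le, integral_Ioc_eq_integral_Ioo,
    integral_Ioc_eq_integral_Ioo] at this
  rw [this]
  simp only [mul_zero, sub_zero, zero_sub]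
  congr 1
  apply integral_congr_ae
  filter_upwards [hv] with x hx
  rw [hx]

lemma intervalIntegrable_of_integrable_vol {L : ℝ} (hL : 0 < L) {v : ℝ → ℝ}
    (hv : Integrable v (vol L)) : IntervalIntegrable v volume 0 L := by
  rw [intervalIntegrable_iff_integrableOn_Ioo_of_le hL.le]
  exact hv

/-- A function which is the indefinite integral of an integrable function is absolutely
continuous with the expected derivative. -/
lemma primitive_properties {L : ℝ} (hL : 0 < L) {v : ℝ → ℝ} (hv : Integrable v (vol L)) (c : ℝ) :
    AbsolutelyContinuousOnInterval (fun x => c + ∫ s in (0 : ℝ)..x, v s) 0 L ∧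
      ∀ᵐ x ∂vol L, HasDerivAt (fun x => c + ∫ s in (0 : ℝ)..x, v s) (v x) x := by
  have hi := intervalIntegrable_of_integrable_vol hL hv
  constructor
  · have h1 := hi.absolutelyContinuousOnInterval_intervalIntegral (c := 0) (by simp)
    have h2 : AbsolutelyContinuousOnInterval (fun _ : ℝ => c) 0 L :=
      contDiffOn_const.absolutelyContinuousOnInterval
    exact h2.add h1
  · rw [ae_restrict_iff' measurableSet_Ioo]
    filter_upwards [hi.ae_hasDerivAt_integral] with x hx hx'
    refine (hx ?_ 0 (by simp)).const_add c
    rw [uIcc_of_le hL.le]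
    exact Ioo_subset_Icc_self hx'

/-- The lemma of du Bois-Reymond. -/
lemma ae_eq_const_of_integral_mul_deriv_eq_zero {L : ℝ} (hL : 0 < L) {w : ℝ → ℝ}
    (hw : Integrable w (vol L))
    (h : ∀ ψ : ℝ → ℝ, ContDiff ℝ ∞ ψ → HasCompactSupport ψ → tsupport ψ ⊆ Ioo 0 L →
      ∫ x in Ioo 0 L, w x * deriv ψ x = 0) : ∃ c, ∀ᵐ x ∂vol L, w x = c := by
  have hint : ∀ θ : ℝ → ℝ, Continuous θ → HasCompactSupport θ →
      Integrable (fun x => w x * θ x) (vol L) := by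
    intro θ hθ hc
    obtain ⟨K, hK⟩ := hc.exists_bound_of_continuous hθ
    exact hw.mul_bdd (c := K) hθ.aestronglyMeasurable (Eventually.of_forall hK)
  -- A reference test function of integral one; the radii keep its support inside `(0, L)`. The
  -- constant is then `∫ w θ₀`.
  let B : ContDiffBump (L / 2) := ⟨L / 8, L / 4, by positivity, by linarith⟩
  have hBs : tsupport (B.normed volume) ⊆ Ioo 0 L := by
    rw [B.tsupport_normed_eq, Real.closedBall_eq_Icc]
    exact Icc_subset_Ioo (by change 0 < L / 2 - L / 4; linarith)
      (by change L / 2 + L / 4 < L; linarith)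
  have hIoo : ∀ θ : ℝ → ℝ, tsupport θ ⊆ Ioo 0 L → ∫ x in (0 : ℝ)..L, θ x = ∫ x, θ x := by
    intro θ hs
    rw [intervalIntegral.integral_of_le hL.le, integral_Ioc_eq_integral_Ioo,
      setIntegral_eq_integral_of_forall_compl_eq_zero]
    exact fun x hx => image_eq_zero_of_notMem_tsupport fun h => hx (hs h)
  set θ₀ := B.normed volume with hθ₀
  have hθ₀c : ContDiff ℝ ∞ θ₀ := B.contDiff_normed
  have hθ₀s : HasCompactSupport θ₀ := B.hasCompactSupport_normed
  have hθ₀1 : ∫ x, θ₀ x = 1 := B.integral_normed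
  refine ⟨∫ x in Ioo 0 L, w x * θ₀ x, ?_⟩
  set c := ∫ x in Ioo 0 L, w x * θ₀ x
  have := isOpen_Ioo.ae_eq_zero_of_integral_contDiff_smul_eq_zero (U := Ioo 0 L)
    (f := fun x => w x - c) (μ := vol L)
    ((hw.sub (integrable_const c)).locallyIntegrable.locallyIntegrableOn _) (by
      intro θ hθ hc hs
      have hIθ : ∫ x in Ioo 0 L, θ x = ∫ x, θ x := by
        rw [← hIoo θ hs, intervalIntegral.integral_of_le hL.le, integral_Ioc_eq_integral_Ioo]
      set m := ∫ x, θ x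
      -- Subtracting `m θ₀` removes the mean of `θ`, so the difference is the derivative of a test
      -- function and the hypothesis applies to it.
      have hts : tsupport (fun x => θ x - m * θ₀ x) ⊆ Ioo 0 L := by
        refine (tsupport_sub θ (fun x => m * θ₀ x)).trans (union_subset hs ?_)
        exact (tsupport_mul_subset_right (f := fun _ => m) (g := θ₀)).trans hBs
      have hcs : HasCompactSupport (fun x => θ x - m * θ₀ x) :=
        hc.sub (hθ₀s.mul_left (f := fun _ => m))
      obtain ⟨ψ, hψ, hψc, hψs, hψd⟩ := exists_test_primitive hL
        (hθ.sub (contDiff_const.mul hθ₀c)) hcs hts (by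
          rw [hIoo _ hts, integral_sub (hθ.continuous.integrable_of_hasCompactSupport hc)
            ((hθ₀c.continuous.integrable_of_hasCompactSupport hθ₀s).const_mul m),
            integral_const_mul, hθ₀1]
          simp [m])
      have e := h ψ hψ hψc hψs
      rw [hψd] at e
      have e2 : ∫ x in Ioo 0 L, w x * (θ x - m * θ₀ x)
          = (∫ x in Ioo 0 L, w x * θ x) - m * c := by
        rw [← integral_const_mul, ← integral_sub (hint θ hθ.continuous hc)
          ((hint θ₀ hθ₀c.continuous hθ₀s).const_mul m)]
        congr 1; ext x; ring
      have e3 : ∫ x in Ioo 0 L, θ x • (w x - c) = (∫ x in Ioo 0 L, w x * θ x) - c * m := by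
        rw [← hIθ, ← integral_const_mul, ← integral_sub (hint θ hθ.continuous hc)
          (((hθ.continuous.integrable_of_hasCompactSupport hc).restrict).const_mul c)]
        congr 1; ext x; simp; ring
      rw [e3]
      linarith [e2.symm.trans e])
  filter_upwards [this, ae_restrict_mem measurableSet_Ioo] with x h1 h2
  linarith [h1 h2]

/-- A continuous function with an integrable weak derivative is its indefinite integral. -/
lemma IsWeakDeriv.eq_add_integral {L : ℝ} (hL : 0 < L) {u v : ℝ → ℝ} (h : IsWeakDeriv L u v)
    (hu : ContinuousOn u (Icc 0 L)) (hv : Integrable v (vol L)) :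
    ∀ x ∈ Icc 0 L, u x = u 0 + ∫ s in (0 : ℝ)..x, v s := by
  obtain ⟨hac, hder⟩ := primitive_properties hL hv 0
  simp only [zero_add] at hac hder
  have hui : Integrable u (vol L) :=
    (hu.integrableOn_compact isCompact_Icc).mono_set Ioo_subset_Icc_self
  have hVc : ContinuousOn (fun x => ∫ s in (0 : ℝ)..x, v s) (Icc 0 L) := by
    have := hac.continuousOn
    rwa [uIcc_of_le hL.le] at this
  have hVi : Integrable (fun x => ∫ s in (0 : ℝ)..x, v s) (vol L) :=
    (hVc.integrableOn_compact isCompact_Icc).mono_set Ioo_subset_Icc_self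
  have hVw := isWeakDeriv_of_absolutelyContinuous hL hac (hder.mono fun x hx => hx.deriv)
  obtain ⟨c, hc⟩ := ae_eq_const_of_integral_mul_deriv_eq_zero hL (hui.sub hVi) (by
    intro ψ hψ hψc hψs
    have hd : Continuous (deriv ψ) := hψ.continuous_deriv (by simp)
    obtain ⟨K, hK⟩ := hψc.deriv.exists_bound_of_continuous hd
    have e := integral_sub (hui.mul_bdd (c := K) hd.aestronglyMeasurable (Eventually.of_forall hK))
      (hVi.mul_bdd (c := K) hd.aestronglyMeasurable (Eventually.of_forall hK))
    simp only [Pi.sub_apply, sub_mul]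
    rw [e, h ψ hψ hψc hψs, hVw ψ hψ hψc hψs, sub_self])
  -- Continuity upgrades equality almost everywhere to equality on the open interval, and then on
  -- its closure.
  have hE : EqOn (fun x => u x - ∫ s in (0 : ℝ)..x, v s) (fun _ => c) (Ioo 0 L) :=
    Measure.eqOn_open_of_ae_eq hc isOpen_Ioo
      ((hu.sub hVc).mono Ioo_subset_Icc_self) continuousOn_const
  have hE' : EqOn (fun x => u x - ∫ s in (0 : ℝ)..x, v s) (fun _ => c) (Icc 0 L) :=
    hE.of_subset_closure (hu.sub hVc) continuousOn_const Ioo_subset_Icc_self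
      (by rw [closure_Ioo hL.ne])
  intro x hx
  have e1 := hE' hx
  have e0 := hE' (left_mem_Icc.2 hL.le)
  simp only [intervalIntegral.integral_same] at e0 e1
  linarith

/-- The continuous representative of an element of `H^1(0, L)` is the indefinite integral of its
weak derivative. -/
lemma Represents.eq_add_integral {L : ℝ} (hL : 0 < L) {u : H L 1} {w : ℝ → ℝ}
    (h : Represents u w) (hw : ContinuousOn w (Icc 0 L)) :
    ∀ x ∈ Icc 0 L, w x = w 0 + ∫ s in (0 : ℝ)..x, u.1 1 s := by
  refine IsWeakDeriv.eq_add_integral hL ?_ hw ((Lp.memLp (u.1 1)).integrable (by norm_num))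
  intro ψ hψ hc hs
  have := u.2 0 ψ hψ hc hs
  refine Eq.trans (integral_congr_ae ?_) this
  filter_upwards [h] with x hx
  simp only [Fin.castSucc_zero]
  rw [hx]

lemma absolutelyContinuousOnInterval_comp {W Θ : ℝ → ℝ} {a b : ℝ} {K : NNReal}
    (hΘ : LipschitzWith K Θ) (hW : AbsolutelyContinuousOnInterval W a b) :
    AbsolutelyContinuousOnInterval (fun x => Θ (W x)) a b := by
  rw [absolutelyContinuousOnInterval_iff] at hW ⊢
  intro ε hε
  -- Dividing by `K + 1` rather than `K` covers the case `K = 0`.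
  obtain ⟨δ, hδ, h⟩ := hW (ε / (K + 1)) (by positivity)
  refine ⟨δ, hδ, fun E hE hlt => ?_⟩
  have h1 := h E hE hlt
  rw [lt_div_iff₀ (by positivity)] at h1
  refine lt_of_le_of_lt ?_ h1
  rw [Finset.sum_mul]
  refine Finset.sum_le_sum fun i _ => (hΘ.dist_le_mul _ _).trans ?_
  rw [mul_comm]
  gcongr
  linarith

/-- The chain rule in `H^1(0, L)`. -/
lemma exists_comp_memH {L : ℝ} (hL : 0 < L) {u : H L 1} {w : ℝ → ℝ} (h : Represents u w)
    (hw : ContinuousOn w (Icc 0 L)) {Θ Θ' : ℝ → ℝ} (hΘ : ∀ y, HasDerivAt Θ (Θ' y) y)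
    (hΘ'c : Continuous Θ') {K : ℝ} (hK : ∀ y, |Θ' y| ≤ K) :
    ∃ z : H L 1, (z.1 0 =ᵐ[vol L] fun x => Θ (w x)) ∧
      (z.1 1 =ᵐ[vol L] fun x => Θ' (w x) * u.1 1 x) := by
  have hW := h.eq_add_integral hL hw
  have hvi : Integrable (u.1 1) (vol L) := (Lp.memLp (u.1 1)).integrable (by norm_num)
  obtain ⟨hac, hder⟩ := primitive_properties hL hvi (w 0)
  have hK0 : 0 ≤ K := (abs_nonneg _).trans (hK 0)
  have hlip : LipschitzWith ⟨K, hK0⟩ Θ :=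
    lipschitzWith_of_nnnorm_deriv_le (fun y => (hΘ y).differentiableAt) fun y => by
      rw [(hΘ y).deriv]
      exact hK y
  have hac2 := absolutelyContinuousOnInterval_comp hlip hac
  have hmem : ∀ᵐ x ∂vol L, x ∈ Ioo 0 L := ae_restrict_mem measurableSet_Ioo
  have hwk : IsWeakDeriv L (fun x => Θ (w x)) (fun x => Θ' (w x) * u.1 1 x) := by
    have h1 := isWeakDeriv_of_absolutelyContinuous hL hac2
      (v := fun x => Θ' (w x) * u.1 1 x) (by
        filter_upwards [hder, hmem] with x hx hx'
        rw [hW x (Ioo_subset_Icc_self hx')]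
        exact ((hΘ _).comp x hx).deriv)
    intro ψ hψ hc hs
    rw [← h1 ψ hψ hc hs]
    refine setIntegral_congr_fun measurableSet_Ioo fun x hx => ?_
    simp only
    rw [hW x (Ioo_subset_Icc_self hx)]
  have hΘc : Continuous Θ := hlip.continuous
  have hwm : AEStronglyMeasurable w (vol L) :=
    (hw.mono Ioo_subset_Icc_self).aestronglyMeasurable measurableSet_Ioo
  have m0 : MemLp (fun x => Θ (w x)) 2 (vol L) := by
    obtain ⟨M, hM⟩ := isCompact_Icc.exists_bound_of_continuousOn (hΘc.comp_continuousOn hw)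
    refine MemLp.of_bound (hΘc.comp_aestronglyMeasurable hwm) M ?_
    filter_upwards [hmem] with x hx using hM x (Ioo_subset_Icc_self hx)
  have m1 : MemLp (fun x => Θ' (w x) * u.1 1 x) 2 (vol L) := by
    refine MemLp.of_le_mul (c := K) (Lp.memLp (u.1 1))
      ((hΘ'c.comp_aestronglyMeasurable hwm).mul (Lp.aestronglyMeasurable _)) ?_
    refine Eventually.of_forall fun x => ?_
    rw [norm_mul]
    gcongr
    exact hK _
  refine ⟨⟨WithLp.toLp 2 ![m0.toLp _, m1.toLp _], ?_⟩, m0.coeFn_toLp, m1.coeFn_toLp⟩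
  intro j ψ hψ hc hs
  fin_cases j
  have e := hwk ψ hψ hc hs
  have e0 : ∫ x in Ioo 0 L, (m0.toLp _) x * deriv ψ x
      = ∫ x in Ioo 0 L, Θ (w x) * deriv ψ x := by
    apply integral_congr_ae
    filter_upwards [m0.coeFn_toLp] with x hx
    rw [hx]
  have e1 : ∫ x in Ioo 0 L, (m1.toLp _) x * ψ x
      = ∫ x in Ioo 0 L, Θ' (w x) * u.1 1 x * ψ x := by
    apply integral_congr_ae
    filter_upwards [m1.coeFn_toLp] with x hx
    rw [hx]
  exact e0.trans (e.trans (congrArg _ e1.symm))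

/-! ### Joint continuity and the weak equation between two times. -/

/-- Functions in `C([0, T], C^α)` are jointly continuous. -/
lemma ContIntoHolder.continuousOn {L T α : ℝ} {h : ℝ → ℝ → ℝ}
    (hh : ContIntoHolder L T α h) :
    ContinuousOn (fun p : ℝ × ℝ => h p.1 p.2) (Icc 0 T ×ˢ Icc 0 L) := by
  rintro ⟨t, x⟩ ⟨ht, hx⟩
  rw [Metric.continuousWithinAt_iff]
  intro η hη
  obtain ⟨ρ, hρ, h1⟩ := hh.2 t ht (η / 2) (by positivity)
  obtain ⟨ρ', hρ', h2⟩ := Metric.continuousWithinAt_iff.1 ((hh.1 t ht).1 x hx) (η / 2)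
    (by positivity)
  refine ⟨min ρ ρ', lt_min hρ hρ', ?_⟩
  rintro ⟨s, y⟩ ⟨hs, hy⟩ hd
  rw [Prod.dist_eq, max_lt_iff] at hd
  have e1 := (h1 s hs (by rw [← Real.dist_eq]; exact hd.1.trans_le (min_le_left _ _))).1 y hy
  have e2 := h2 hy (hd.2.trans_le (min_le_right _ _))
  rw [Real.dist_eq] at e2 ⊢
  calc |h s y - h t x| = |(h s y - h t y) + (h t y - h t x)| := by ring_nf
    _ ≤ |h s y - h t y| + |h t y - h t x| := abs_add_le _ _
    _ < η := by linarith

lemma continuousOn_slice {L T : ℝ} {h : ℝ → ℝ → ℝ}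
    (hh : ContinuousOn (fun p : ℝ × ℝ => h p.1 p.2) (Icc 0 T ×ˢ Icc 0 L)) {t : ℝ}
    (ht : t ∈ Icc 0 T) : ContinuousOn (h t) (Icc 0 L) :=
  hh.comp (f := fun x => (t, x)) (by fun_prop) fun _ hx => ⟨ht, hx⟩

lemma integrable_of_continuousOn {L : ℝ} {w : ℝ → ℝ} (hw : ContinuousOn w (Icc 0 L)) :
    Integrable w (vol L) :=
  (hw.integrableOn_compact isCompact_Icc).mono_set Ioo_subset_Icc_self

lemma ae_mem_vol {L : ℝ} : ∀ᵐ x ∂vol L, x ∈ Ioo 0 L := ae_restrict_mem measurableSet_Ioo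

/-- Continuity of `t ↦ ∫ Ψ(h(t, x)) z(x) dx`. -/
lemma continuousOn_integral_comp_mul {L T : ℝ} {h : ℝ → ℝ → ℝ}
    (hh : ContinuousOn (fun p : ℝ × ℝ => h p.1 p.2) (Icc 0 T ×ˢ Icc 0 L))
    {Ψ : ℝ → ℝ} (hΨ : Continuous Ψ) {z : ℝ → ℝ} (hz : Integrable z (vol L)) :
    ContinuousOn (fun t => ∫ x in Ioo 0 L, Ψ (h t x) * z x) (Icc 0 T) := by
  have hc := hΨ.comp_continuousOn hh
  obtain ⟨M, hM⟩ := (isCompact_Icc.prod isCompact_Icc).exists_bound_of_continuousOn hc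
  refine continuousOn_of_dominated (bound := fun x => M * ‖z x‖) ?_ ?_ (hz.norm.const_mul M) ?_
  · intro t ht
    exact (integrable_of_continuousOn
      (hΨ.comp_continuousOn (continuousOn_slice hh ht))).aestronglyMeasurable.mul
        hz.aestronglyMeasurable
  · intro t ht
    filter_upwards [ae_mem_vol] with x hx
    rw [norm_mul]
    gcongr
    exact hM (t, x) ⟨ht, Ioo_subset_Icc_self hx⟩
  · filter_upwards [ae_mem_vol] with x hx
    refine ContinuousOn.mul ?_ continuousOn_const
    exact hc.comp (f := fun t => (t, x)) (by fun_prop)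
      fun t ht => ⟨ht, Ioo_subset_Icc_self hx⟩

lemma integrable_eval_of_memLp {E α : Type*} [NormedAddCommGroup E] [NormedSpace ℝ E]
    [MeasurableSpace α] {ν : Measure α} [IsFiniteMeasure ν] {F : α → StrongDual ℝ E}
    (hF : MemLp F 2 ν) (z : E) : Integrable (fun t => F t z) ν :=
  (ContinuousLinearMap.apply ℝ ℝ z).integrable_comp (hF.integrable (by norm_num))

/-- The weak equation, integrated over a time interval against a fixed element of `H^1`. -/
lemma WeakEquation.integral_sub_mul {L T : ℝ} (hT : 0 < T) {h J : ℝ → ℝ → ℝ}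
    (hw : WeakEquation L T h J)
    (hh : ContinuousOn (fun p : ℝ × ℝ => h p.1 p.2) (Icc 0 T ×ˢ Icc 0 L)) (z : H L 1)
    {t₁ t₂ : ℝ} (h₁ : 0 ≤ t₁) (h₁₂ : t₁ ≤ t₂) (h₂ : t₂ ≤ T) :
    ∫ x in Ioo 0 L, (h t₂ x - h t₁ x) * z.1 0 x
      = ∫ t in Ioo t₁ t₂, ∫ x in Ioo 0 L, J t x * z.1 1 x := by
  obtain ⟨ft, hft, hder, heq⟩ := hw
  have hzi : Integrable (z.1 0) (vol L) := (Lp.memLp (z.1 0)).integrable (by norm_num)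
  have hcont := continuousOn_integral_comp_mul hh continuous_id hzi
  simp only [id] at hcont
  have hfi : Integrable (fun t => ft t z) (vol T) :=
    integrable_eval_of_memLp hft z
  -- Pairing with a fixed `z` turns the time derivative into a scalar weak derivative on `(0, T)`,
  -- to which the spatial one-dimensional theory applies with `T` as interval length.
  have hwd : IsWeakDeriv T (fun t => ∫ x in Ioo 0 L, h t x * z.1 0 x) (fun t => ft t z) := by
    intro η hη hc hs
    have := hder z η hη hc hs
    simp only [mul_comm] at this ⊢
    exact this
  have hF := hwd.eq_add_integral hT hcont hfi
  have hii := intervalIntegrable_of_integrable_vol hT hfi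
  have e1 : ∫ x in Ioo 0 L, (h t₂ x - h t₁ x) * z.1 0 x = ∫ t in Ioo t₁ t₂, ft t z := by
    have hint : ∀ t ∈ Icc 0 T, Integrable (fun x => h t x * z.1 0 x) (vol L) := by
      intro t ht
      obtain ⟨M, hM⟩ := isCompact_Icc.exists_bound_of_continuousOn (continuousOn_slice hh ht)
      refine hzi.bdd_mul (c := M)
        (integrable_of_continuousOn (continuousOn_slice hh ht)).aestronglyMeasurable ?_
      filter_upwards [ae_mem_vol] with x hx using hM x (Ioo_subset_Icc_self hx)
    have m₁ : t₁ ∈ Icc 0 T := ⟨h₁, h₁₂.trans h₂⟩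
    have m₂ : t₂ ∈ Icc 0 T := ⟨h₁.trans h₁₂, h₂⟩
    simp only [sub_mul]
    rw [integral_sub (hint t₂ m₂) (hint t₁ m₁)]
    have a1 := hF t₁ m₁
    have a2 := hF t₂ m₂
    simp only at a1 a2
    rw [a1, a2, ← integral_Ioc_eq_integral_Ioo (x := t₁) (y := t₂),
      ← intervalIntegral.integral_of_le h₁₂]
    have := intervalIntegral.integral_add_adjacent_intervals
      (hii.mono_set (c := 0) (d := t₁) (by
        rw [uIcc_of_le h₁, uIcc_of_le hT.le]; exact Icc_subset_Icc_right m₁.2))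
      (hii.mono_set (c := t₁) (d := t₂) (by
        rw [uIcc_of_le h₁₂, uIcc_of_le hT.le]; exact Icc_subset_Icc h₁ h₂))
    linarith
  have hsub : Ioo t₁ t₂ ⊆ Ioo 0 T := Ioo_subset_Ioo h₁ h₂
  -- Test functions need only be square integrable in time, so a sharp cut-off to `(t₁, t₂)` is
  -- admissible.
  have hξ : MemLp ((Ioo t₁ t₂).indicator fun _ => z) 2 (vol T) :=
    (memLp_const z).indicator measurableSet_Ioo
  have e2 := heq _ hξ
  have e3 : ∫ t in Ioo 0 T, ft t ((Ioo t₁ t₂).indicator (fun _ => z) t)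
      = ∫ t in Ioo t₁ t₂, ft t z := by
    have : (fun t => ft t ((Ioo t₁ t₂).indicator (fun _ => z) t))
        = (Ioo t₁ t₂).indicator fun t => ft t z := by
      ext t
      by_cases ht : t ∈ Ioo t₁ t₂ <;> simp [ht]
    rw [this, setIntegral_indicator measurableSet_Ioo, inter_eq_right.2 hsub]
  have e4 : ∫ t in Ioo 0 T, ∫ x in Ioo 0 L,
        J t x * ((Ioo t₁ t₂).indicator (fun _ => z) t).1 1 x
      = ∫ t in Ioo t₁ t₂, ∫ x in Ioo 0 L, J t x * z.1 1 x := by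
    have : (fun t => ∫ x in Ioo 0 L, J t x * ((Ioo t₁ t₂).indicator (fun _ => z) t).1 1 x)
        = (Ioo t₁ t₂).indicator fun t => ∫ x in Ioo 0 L, J t x * z.1 1 x := by
      ext t
      by_cases ht : t ∈ Ioo t₁ t₂
      · simp [ht]
      · simp only [ht, not_false_eq_true, indicator_of_notMem]
        apply integral_eq_zero_of_ae
        filter_upwards [Lp.coeFn_zero ℝ 2 (vol L)] with x hx
        exact mul_eq_zero_of_right _ hx
    rw [this, setIntegral_indicator measurableSet_Ioo, inter_eq_right.2 hsub]
  rw [e1, ← e3, e2, e4]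

/-! ### Cauchy–Schwarz and chaining of short time steps. -/

/-- Cauchy–Schwarz inequality. -/
lemma integral_sqrt_mul_abs_le {α : Type*} [MeasurableSpace α] {ν : Measure α} {p v : α → ℝ}
    (hp : Integrable p ν) (hp0 : ∀ᵐ x ∂ν, 0 ≤ p x) (hv : MemLp v 2 ν) :
    Integrable (fun x => √(p x) * |v x|) ν ∧
      ∫ x, √(p x) * |v x| ∂ν ≤ √(∫ x, p x ∂ν) * √(∫ x, v x ^ 2 ∂ν) := by
  have hsm : MemLp (fun x => √(p x)) 2 ν := by
    rw [memLp_two_iff_integrable_sq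
      (Real.continuous_sqrt.comp_aestronglyMeasurable hp.aestronglyMeasurable)]
    refine hp.congr ?_
    filter_upwards [hp0] with x hx
    rw [Real.sq_sqrt hx]
  refine ⟨hsm.integrable_mul hv.abs, ?_⟩
  have := integral_mul_le_Lp_mul_Lq_of_nonneg (μ := ν) Real.HolderConjugate.two_two
    (f := fun x => √(p x)) (g := fun x => |v x|)
    (Eventually.of_forall fun x => Real.sqrt_nonneg _)
    (Eventually.of_forall fun x => abs_nonneg _) (by simpa using hsm)
    (by rw [ENNReal.ofReal_ofNat]; exact hv.abs)
  refine this.trans (le_of_eq ?_)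
  rw [Real.sqrt_eq_rpow, Real.sqrt_eq_rpow]
  congr 2
  · apply integral_congr_ae
    filter_upwards [hp0] with x hx
    norm_num
    rw [Real.sq_sqrt hx]
  · congr 1
    ext x
    norm_num

/-- A continuous function on `[0, T]` which is locally non-increasing towards almost every
point satisfies `D T ≤ D 0`. -/
lemma le_of_locally_antitone {T ρ : ℝ} (hT : 0 < T) (hρ : 0 < ρ) {D : ℝ → ℝ} {S : Set ℝ}
    (hD : ContinuousOn D (Icc 0 T)) (hS : ∀ᵐ t ∂vol T, t ∈ S)
    (h : ∀ t₁ t₂, 0 ≤ t₁ → t₁ ≤ t₂ → t₂ ≤ T → t₂ ∈ S → t₂ - t₁ ≤ ρ → D t₂ ≤ D t₁) :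
    D T ≤ D 0 := by
  have key : ∀ t₁ t₂, 0 ≤ t₁ → t₁ < t₂ → t₂ ≤ T → t₂ - t₁ ≤ ρ → D t₂ ≤ D t₁ := by
    intro t₁ t₂ h₁ h₁₂ h₂ hρ'
    -- An arbitrary endpoint is a limit from the left of points of `S`; continuity of `D` then
    -- removes the condition `t₂ ∈ S`.
    have hcl : t₂ ∈ closure (S ∩ Ioo t₁ t₂) := by
      rw [Metric.mem_closure_iff]
      intro r hr
      by_contra hcon
      push Not at hcon
      -- If no point of `S` came within `r` of `t₂` from the left, this nonempty interval would lie
      -- in the null complement of `S`.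
      have hz : volume (Ioo (max t₁ (t₂ - r)) t₂) = 0 := by
        refine measure_mono_null ?_
          ((ae_iff.1 (ae_imp_of_ae_restrict hS)))
        intro t ht hS'
        have htm : t ∈ Ioo t₁ t₂ := ⟨(le_max_left _ _).trans_lt ht.1, ht.2⟩
        have hb := hcon t ⟨hS' ⟨h₁.trans_lt htm.1, htm.2.trans_le h₂⟩, htm⟩
        rw [Real.dist_eq, abs_of_pos (by linarith [ht.2])] at hb
        linarith [(le_max_right t₁ (t₂ - r)).trans_lt ht.1]
      rw [Real.volume_Ioo, ENNReal.ofReal_eq_zero] at hz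
      have := max_lt h₁₂ (show t₂ - r < t₂ by linarith)
      linarith
    have hsub : S ∩ Ioo t₁ t₂ ⊆ Icc 0 T :=
      fun t ht => ⟨h₁.trans ht.2.1.le, ht.2.2.le.trans h₂⟩
    refine ContinuousWithinAt.closure_le hcl
      ((hD t₂ ⟨h₁.trans h₁₂.le, h₂⟩).mono hsub) continuousWithinAt_const fun t ht => ?_
    exact h t₁ t h₁ ht.2.1.le (ht.2.2.le.trans h₂) ht.1 (by linarith [ht.2.2])
  obtain ⟨n, hn⟩ := exists_nat_gt (T / ρ)
  have hn0 : (0 : ℝ) < n := (by positivity : (0 : ℝ) < T / ρ).trans hn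
  have hstep : T / n ≤ ρ := by
    rw [div_lt_iff₀ hρ] at hn
    rw [div_le_iff₀ hn0]
    linarith
  have hind : ∀ k : ℕ, k ≤ n → D (k * (T / n)) ≤ D 0 := by
    intro k
    induction k with
    | zero => intro _; simp
    | succ k ih =>
      intro hk
      refine le_trans ?_ (ih (by omega))
      have hp : 0 < T / n := by positivity
      refine key _ _ (by positivity) ?_ ?_ ?_
      · push_cast; linarith
      · calc ((k + 1 : ℕ) : ℝ) * (T / n) ≤ n * (T / n) := by gcongr
          _ = T := by field_simp
      · push_cast; linarith
  have := hind n le_rfl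
  rwa [mul_div_cancel₀ _ hn0.ne'] at this

/-! ### The convex cut-off `χ_δ`. -/

section Chi

variable {φ : ℝ → ℝ}

lemma tail_eq_zero (hφs : tsupport φ ⊆ Icc (-1) 0) {s : ℝ} (hs : 0 ≤ s) :
    ∫ τ in Ioi s, φ τ = 0 := by
  refine setIntegral_eq_zero_of_forall_eq_zero fun τ hτ => ?_
  exact image_eq_zero_of_notMem_tsupport fun h => by
    have := (hφs h).2
    have : s < τ := hτ
    linarith

lemma tail_eq_one (hφs : tsupport φ ⊆ Icc (-1) 0) (hφ1 : ∫ x, φ x = 1) {s : ℝ} (hs : s ≤ -1) :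
    ∫ τ in Ioi s, φ τ = 1 := by
  rw [← hφ1, ← integral_Ici_eq_integral_Ioi]
  refine setIntegral_eq_integral_of_forall_compl_eq_zero fun τ hτ => ?_
  refine image_eq_zero_of_notMem_tsupport fun h => hτ ?_
  exact hs.trans (hφs h).1

lemma integrable_of_tsupport_subset (hφ : Continuous φ) (hφs : tsupport φ ⊆ Icc (-1) 0) :
    Integrable φ :=
  hφ.integrable_of_hasCompactSupport (isCompact_Icc.of_isClosed_subset (isClosed_tsupport φ) hφs)

lemma tail_antitone (hφ : Continuous φ) (hφ0 : ∀ x, 0 ≤ φ x) (hφs : tsupport φ ⊆ Icc (-1) 0) :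
    Antitone fun s => ∫ τ in Ioi s, φ τ := fun _ _ hab =>
  setIntegral_mono_set (integrable_of_tsupport_subset hφ hφs).integrableOn
    (Eventually.of_forall hφ0) (Ioi_subset_Ioi hab).eventuallyLE

lemma hasDerivAt_tail (hφ : Continuous φ) (hφs : tsupport φ ⊆ Icc (-1) 0) (s : ℝ) :
    HasDerivAt (fun s => ∫ τ in Ioi s, φ τ) (-φ s) s := by
  have hi := integrable_of_tsupport_subset hφ hφs
  have e : (fun s => ∫ τ in Ioi s, φ τ)
      = fun s => (∫ τ in Ioi 0, φ τ) - ∫ τ in (0 : ℝ)..s, φ τ := by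
    ext s
    rw [← intervalIntegral.integral_interval_add_Ioi (hi.integrableOn (s := Ioi 0))
      (hi.integrableOn (s := Ioi s))]
    ring
  rw [e]
  exact (intervalIntegral.integral_hasDerivAt_right (hφ.intervalIntegrable _ _)
    (hφ.stronglyMeasurableAtFilter _ _) hφ.continuousAt).const_sub _

/-- The first derivative of `χ_δ` is `-∫_{x/δ}^∞ φ`. -/
lemma hasDerivAt_chi (hφ : Continuous φ) (hφs : tsupport φ ⊆ Icc (-1) 0) {δ : ℝ} (hδ : 0 < δ)
    (x : ℝ) : HasDerivAt (chi φ δ) (-∫ τ in Ioi (x / δ), φ τ) x := by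
  have hc : Continuous fun s => ∫ τ in Ioi s, φ τ :=
    continuous_iff_continuousAt.2 fun s => (hasDerivAt_tail hφ hφs s).continuousAt
  have h1 : HasDerivAt (fun y => ∫ s in (0 : ℝ)..y, ∫ τ in Ioi s, φ τ)
      (∫ τ in Ioi (x / δ), φ τ) (x / δ) :=
    intervalIntegral.integral_hasDerivAt_right (hc.intervalIntegrable _ _)
      (hc.stronglyMeasurableAtFilter _ _) hc.continuousAt
  have h2 : HasDerivAt (fun y : ℝ => y / δ) (1 / δ) x := (hasDerivAt_id x).div_const δ
  have h3 := ((h1.comp x h2).neg).const_mul δ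
  refine h3.congr_deriv ?_
  field_simp

/-- The second derivative of `χ_δ` is `φ(x/δ)/δ`. -/
lemma hasDerivAt_deriv_chi (hφ : Continuous φ) (hφs : tsupport φ ⊆ Icc (-1) 0) (δ x : ℝ) :
    HasDerivAt (fun x => -∫ τ in Ioi (x / δ), φ τ) (φ (x / δ) / δ) x := by
  have h2 : HasDerivAt (fun y : ℝ => y / δ) (1 / δ) x := (hasDerivAt_id x).div_const δ
  refine (((hasDerivAt_tail hφ hφs (x / δ)).comp x h2).neg).congr_deriv ?_
  ring

lemma continuous_chi (hφ : Continuous φ) (hφs : tsupport φ ⊆ Icc (-1) 0) {δ : ℝ} (hδ : 0 < δ) :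
    Continuous (chi φ δ) :=
  continuous_iff_continuousAt.2 fun x => (hasDerivAt_chi hφ hφs hδ x).continuousAt

/-- Convexity of `χ_δ`. -/
lemma chi_sub_le (hφ : Continuous φ) (hφ0 : ∀ x, 0 ≤ φ x) (hφs : tsupport φ ⊆ Icc (-1) 0)
    {δ : ℝ} (hδ : 0 < δ) (y z : ℝ) :
    chi φ δ y - chi φ δ z ≤ (y - z) * -∫ τ in Ioi (y / δ), φ τ := by
  have hc := continuous_chi hφ hφs hδ
  have hm : ∀ a b : ℝ, a ≤ b → ∫ τ in Ioi (b / δ), φ τ ≤ ∫ τ in Ioi (a / δ), φ τ :=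
    fun a b hab => tail_antitone hφ hφ0 hφs (by gcongr)
  rcases lt_trichotomy y z with h | rfl | h
  -- By the mean value theorem the increment is a derivative at an intermediate point; the
  -- derivative is monotone because `φ ≥ 0`.
  · obtain ⟨c, hc', e⟩ := exists_hasDerivAt_eq_slope (chi φ δ) _ h hc.continuousOn
      fun x _ => hasDerivAt_chi hφ hφs hδ x
    rw [eq_div_iff (by linarith)] at e
    nlinarith [hm y c hc'.1.le]
  · simp
  · obtain ⟨c, hc', e⟩ := exists_hasDerivAt_eq_slope (chi φ δ) _ h hc.continuousOn
      fun x _ => hasDerivAt_chi hφ hφs hδ x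
    rw [eq_div_iff (by linarith)] at e
    nlinarith [hm c y hc'.2.le]

lemma chi_zero (δ : ℝ) : chi φ δ 0 = 0 := by simp [chi]

lemma chi_eq_zero (hφs : tsupport φ ⊆ Icc (-1) 0) {δ : ℝ} (hδ : 0 < δ) {y : ℝ} (hy : 0 ≤ y) :
    chi φ δ y = 0 := by
  have : ∫ s in (0 : ℝ)..(y / δ), ∫ τ in Ioi s, φ τ = 0 := by
    refine (intervalIntegral.integral_congr (g := fun _ => (0 : ℝ)) fun s hs => ?_).trans
      (by simp)
    rw [uIcc_of_le (by positivity)] at hs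
    exact tail_eq_zero hφs hs.1
  simp [chi, this]

/-- The tangent at `0` is the zero line, and a convex function lies above its tangents. -/
lemma chi_nonneg (hφ : Continuous φ) (hφ0 : ∀ x, 0 ≤ φ x) (hφs : tsupport φ ⊆ Icc (-1) 0)
    {δ : ℝ} (hδ : 0 < δ) (y : ℝ) : 0 ≤ chi φ δ y := by
  have := chi_sub_le hφ hφ0 hφs hδ 0 y
  rw [chi_zero, zero_div, tail_eq_zero hφs le_rfl] at this
  simp only [neg_zero, mul_zero] at this
  linarith

/-- `χ_δ(y) ≥ -y - δ`. -/
lemma neg_sub_le_chi (hφ : Continuous φ) (hφ0 : ∀ x, 0 ≤ φ x) (hφs : tsupport φ ⊆ Icc (-1) 0)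
    (hφ1 : ∫ x, φ x = 1) {δ : ℝ} (hδ : 0 < δ) (y : ℝ) : -y - δ ≤ chi φ δ y := by
  -- Tangent at `-δ`, where the slope is already `-1` since all the mass of `φ` lies to the right of
  -- `-1`.
  have h := chi_sub_le hφ hφ0 hφs hδ (-δ) y
  rw [neg_div, div_self hδ.ne', tail_eq_one hφs hφ1 le_rfl] at h
  linarith [chi_nonneg hφ hφ0 hφs hδ (-δ)]

end Chi

/-! ### Growth in time of `∫ χ_δ(h)`. -/

/-- The growth of `∫ χ_δ(h(t)) dx` over a short time interval. -/
lemma integral_chi_sub_le {L T : ℝ} (hL : 0 < L) (hT : 0 < T) {φ : ℝ → ℝ} (hφ : Continuous φ)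
    (hφ0 : ∀ x, 0 ≤ φ x) (hφs : tsupport φ ⊆ Icc (-1) 0) {K : ℝ} (hK : ∀ x, φ x ≤ K)
    {δ : ℝ} (hδ : 0 < δ) {h J p : ℝ → ℝ → ℝ} {P : ℝ → ℝ}
    (hh : ContinuousOn (fun p : ℝ × ℝ => h p.1 p.2) (Icc 0 T ×ˢ Icc 0 L))
    (hw : WeakEquation L T h J) {η κ M : ℝ} (hκ : 0 ≤ κ) (hM : 0 ≤ M)
    (hp : ∀ᵐ s ∂vol T, Integrable (p s) (vol L) ∧ ∫ x in Ioo 0 L, p s x = P s ∧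
      ∀ x ∈ Ioo 0 L, 0 ≤ p s x ∧ (h s x ≤ η → J s x ^ 2 ≤ κ ^ 2 * p s x))
    (hP : Integrable (fun s => √(P s)) (vol T)) {t₁ t₂ : ℝ} (h₁ : 0 ≤ t₁) (h₁₂ : t₁ ≤ t₂)
    (h₂ : t₂ ≤ T) {u : H L 1} (hu : Represents u (h t₂))
    (huM : ∫ x in Ioo 0 L, u.1 1 x ^ 2 ≤ M ^ 2)
    (hη : ∀ s ∈ Ioo t₁ t₂, ∀ x ∈ Ioo 0 L, |h s x - h t₂ x| ≤ η) :
    (∫ x in Ioo 0 L, chi φ δ (h t₂ x)) - ∫ x in Ioo 0 L, chi φ δ (h t₁ x)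
      ≤ κ * (K / δ) * M * ∫ s in Ioo t₁ t₂, √(P s) := by
  have m₁ : t₁ ∈ Icc 0 T := ⟨h₁, h₁₂.trans h₂⟩
  have m₂ : t₂ ∈ Icc 0 T := ⟨h₁.trans h₁₂, h₂⟩
  have c₁ := continuousOn_slice hh m₁
  have c₂ := continuousOn_slice hh m₂
  have hK0 : 0 ≤ K := (hφ0 0).trans (hK 0)
  have hχ := continuous_chi hφ hφs hδ
  -- The frozen test function `z = χ_δ'(h(t₂))`, which lies in `H^1` with derivative `χ_δ''(h(t₂))
  -- ∂ₓh(t₂)`.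
  obtain ⟨z, hz0, hz1⟩ := exists_comp_memH hL hu c₂ (hasDerivAt_deriv_chi hφ hφs δ)
    (by fun_prop) (K := K / δ) (fun y => by
      rw [abs_of_nonneg (div_nonneg (hφ0 _) hδ.le)]
      gcongr
      exact hK _)
  have hcont : ContinuousOn (fun x => (h t₂ x - h t₁ x) * -∫ τ in Ioi (h t₂ x / δ), φ τ)
      (Icc 0 L) := by
    have hd : Continuous fun y => -∫ τ in Ioi (y / δ), φ τ :=
      continuous_iff_continuousAt.2 fun y => (hasDerivAt_deriv_chi hφ hφs δ y).continuousAt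
    exact (c₂.sub c₁).mul (hd.comp_continuousOn c₂)
  have hi₁ := integrable_of_continuousOn (hχ.comp_continuousOn c₁)
  have hi₂ := integrable_of_continuousOn (hχ.comp_continuousOn c₂)
  calc (∫ x in Ioo 0 L, chi φ δ (h t₂ x)) - ∫ x in Ioo 0 L, chi φ δ (h t₁ x)
      = ∫ x in Ioo 0 L, (chi φ δ (h t₂ x) - chi φ δ (h t₁ x)) := (integral_sub hi₂ hi₁).symm
    _ ≤ ∫ x in Ioo 0 L, (h t₂ x - h t₁ x) * -∫ τ in Ioi (h t₂ x / δ), φ τ :=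
        integral_mono (hi₂.sub hi₁) (integrable_of_continuousOn hcont)
          fun x => chi_sub_le hφ hφ0 hφs hδ _ _
    _ = ∫ x in Ioo 0 L, (h t₂ x - h t₁ x) * z.1 0 x := by
        apply integral_congr_ae
        filter_upwards [hz0] with x hx
        rw [hx]
    _ = ∫ s in Ioo t₁ t₂, ∫ x in Ioo 0 L, J s x * z.1 1 x :=
        hw.integral_sub_mul hT hh z h₁ h₁₂ h₂
    _ ≤ ∫ s in Ioo t₁ t₂, κ * (K / δ) * M * √(P s) := by
        have hsub : Ioo t₁ t₂ ⊆ Ioo 0 T := Ioo_subset_Ioo h₁ h₂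
        refine (Real.le_norm_self _).trans
          (norm_integral_le_of_norm_le ((hP.mono_measure
            (Measure.restrict_mono hsub le_rfl)).const_mul _) ?_)
        filter_upwards [ae_restrict_of_ae_restrict_of_subset hsub hp,
          ae_restrict_mem measurableSet_Ioo] with s hs hst
        obtain ⟨hpi, hpP, hpx⟩ := hs
        obtain ⟨hci, hcs⟩ := integral_sqrt_mul_abs_le hpi
          (by filter_upwards [ae_mem_vol] with x hx using (hpx x hx).1) (Lp.memLp (u.1 1))
        have hle : ‖∫ x in Ioo 0 L, J s x * z.1 1 x‖
            ≤ ∫ x in Ioo 0 L, κ * (K / δ) * (√(p s x) * |u.1 1 x|) := by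
          refine norm_integral_le_of_norm_le (hci.const_mul _) ?_
          filter_upwards [hz1, ae_mem_vol] with x hx hxm
          rw [hx, Real.norm_eq_abs, abs_mul, abs_mul,
            abs_of_nonneg (div_nonneg (hφ0 _) hδ.le)]
          -- Only points with `φ(h(t₂)/δ) ≠ 0` contribute. There `h(t₂) ≤ 0`, so `h(s) ≤ η` and the
          -- flux bound is available.
          by_cases hzero : φ (h t₂ x / δ) = 0
          · rw [hzero]
            simp only [zero_div, zero_mul, mul_zero]
            positivity
          · have hmem := hφs (subset_tsupport _ hzero)
            have hneg : h t₂ x ≤ 0 := by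
              have := (div_le_iff₀ hδ).1 hmem.2
              linarith
            have hJ := (hpx x hxm).2 (by linarith [(abs_le.1 (hη s hst x hxm)).2])
            have hJ' : |J s x| ≤ κ * √(p s x) := by
              refine Real.abs_le_sqrt hJ |>.trans (le_of_eq ?_)
              rw [Real.sqrt_mul (sq_nonneg _), Real.sqrt_sq hκ]
            calc |J s x| * (φ (h t₂ x / δ) / δ * |u.1 1 x|)
                ≤ (κ * √(p s x)) * (K / δ * |u.1 1 x|) := by
                  have := hφ0 (h t₂ x / δ)
                  gcongr
                  exact hK _
              _ = _ := by ring
        refine hle.trans ?_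
        rw [integral_const_mul]
        rw [hpP] at hcs
        have : √(∫ x in Ioo 0 L, u.1 1 x ^ 2) ≤ M := by
          rw [← Real.sqrt_sq hM]
          exact Real.sqrt_le_sqrt huM
        calc κ * (K / δ) * ∫ x in Ioo 0 L, √(p s x) * |u.1 1 x|
            ≤ κ * (K / δ) * (√(P s) * M) := by
              gcongr
              exact hcs.trans (by gcongr)
          _ = _ := by ring
    _ = _ := integral_const_mul _ _

/-- The growth of `∫ χ_δ(h(t)) dx` over `[0, T]`. -/
lemma integral_chi_final_sub_le {L T : ℝ} (hL : 0 < L) (hT : 0 < T) {φ : ℝ → ℝ}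
    (hφ : Continuous φ) (hφ0 : ∀ x, 0 ≤ φ x) (hφs : tsupport φ ⊆ Icc (-1) 0) {K : ℝ}
    (hK : ∀ x, φ x ≤ K) {δ : ℝ} (hδ : 0 < δ) {h J p : ℝ → ℝ → ℝ} {P : ℝ → ℝ}
    (hh : ContinuousOn (fun p : ℝ × ℝ => h p.1 p.2) (Icc 0 T ×ˢ Icc 0 L))
    (hw : WeakEquation L T h J) {η κ M : ℝ} (hκ : 0 ≤ κ) (hM : 0 ≤ M) (hη : 0 < η)
    (hp : ∀ᵐ s ∂vol T, Integrable (p s) (vol L) ∧ ∫ x in Ioo 0 L, p s x = P s ∧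
      ∀ x ∈ Ioo 0 L, 0 ≤ p s x ∧ (h s x ≤ η → J s x ^ 2 ≤ κ ^ 2 * p s x))
    (hP : Integrable (fun s => √(P s)) (vol T))
    (hu : ∀ᵐ t ∂vol T, ∃ u : H L 1, Represents u (h t) ∧ ∫ x in Ioo 0 L, u.1 1 x ^ 2 ≤ M ^ 2) :
    (∫ x in Ioo 0 L, chi φ δ (h T x)) - ∫ x in Ioo 0 L, chi φ δ (h 0 x)
      ≤ κ * (K / δ) * M * ∫ s in Ioo 0 T, √(P s) := by
  obtain ⟨ρ, hρ, hunif⟩ := Metric.uniformContinuousOn_iff.1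
    ((isCompact_Icc.prod isCompact_Icc).uniformContinuousOn_of_continuous hh) η hη
  set c := κ * (K / δ) * M with hc
  have hii := intervalIntegrable_of_integrable_vol hT hP
  have hXc : ContinuousOn (fun t => ∫ x in Ioo 0 L, chi φ δ (h t x)) (Icc 0 T) := by
    have := continuousOn_integral_comp_mul hh (continuous_chi hφ hφs hδ)
      (integrable_const (μ := vol L) (1 : ℝ))
    simpa using this
  have hNc : ContinuousOn (fun t => ∫ s in (0 : ℝ)..t, √(P s)) (Icc 0 T) := by
    have := (hii.absolutelyContinuousOnInterval_intervalIntegral (c := 0) (by simp)).continuousOn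
    rwa [uIcc_of_le hT.le] at this
  -- Subtracting the bound itself turns the increment estimate into monotonicity, valid for
  -- endpoints `t₂` where `h(t₂)` has the `H^1` bound. Steps of length `ρ / 2` meet the strict
  -- inequality of uniform continuity.
  have key := le_of_locally_antitone hT (ρ := ρ / 2) (by positivity)
    (D := fun t => (∫ x in Ioo 0 L, chi φ δ (h t x)) - c * ∫ s in (0 : ℝ)..t, √(P s))
    (hXc.sub (hNc.const_mul c)) hu (by
      rintro t₁ t₂ h₁ h₁₂ h₂ ⟨u, hu, huM⟩ hlt
      have := integral_chi_sub_le hL hT hφ hφ0 hφs hK hδ hh hw hκ hM hp hP h₁ h₁₂ h₂ hu huM (by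
        intro s hs x hx
        have hx' := Ioo_subset_Icc_self hx
        have := hunif (s, x) ⟨⟨h₁.trans hs.1.le, hs.2.le.trans h₂⟩, hx'⟩ (t₂, x)
          ⟨⟨h₁.trans h₁₂, h₂⟩, hx'⟩ (by
            rw [Prod.dist_eq, dist_self, max_eq_left dist_nonneg, Real.dist_eq, abs_sub_comm,
              abs_of_nonneg (by linarith [hs.2])]
            linarith [hs.1])
        exact this.le)
      have hadd := intervalIntegral.integral_add_adjacent_intervals
        (hii.mono_set (c := 0) (d := t₁) (by
          rw [uIcc_of_le h₁, uIcc_of_le hT.le]; exact Icc_subset_Icc_right (h₁₂.trans h₂)))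
        (hii.mono_set (c := t₁) (d := t₂) (by
          rw [uIcc_of_le h₁₂, uIcc_of_le hT.le]; exact Icc_subset_Icc h₁ h₂))
      rw [← integral_Ioc_eq_integral_Ioo (x := t₁), ← intervalIntegral.integral_of_le h₁₂,
        ← hc] at this
      rw [← hadd]
      linarith)
  simp only [intervalIntegral.integral_same, mul_zero, sub_zero] at key
  rw [intervalIntegral.integral_of_le hT.le, integral_Ioc_eq_integral_Ioo] at key
  linarith

/-! ### Integrability in time of the dissipation. -/

section Quadratic

variable {L T : ℝ}

lemma integral_abs_mul_abs_le (u v : Lp ℝ 2 (vol L)) :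
    ∫ x, |u x| * |v x| ∂vol L ≤ ‖u‖ * ‖v‖ := by
  have h : inner ℝ |u| |v| = ∫ x, |u x| * |v x| ∂vol L := by
    rw [L2.inner_def]
    apply integral_congr_ae
    filter_upwards [Lp.coeFn_abs u, Lp.coeFn_abs v] with x hx hy
    rw [hx, hy]
    simp [mul_comm]
  rw [← h, ← norm_abs_eq_norm u, ← norm_abs_eq_norm v]
  exact real_inner_le_norm _ _

lemma integrable_mul_mul {c : ℝ → ℝ} (hc : AEStronglyMeasurable c (vol L)) {M : ℝ}
    (hM : ∀ᵐ x ∂vol L, |c x| ≤ M) (u v : Lp ℝ 2 (vol L)) :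
    Integrable (fun x => c x * (u x * v x)) (vol L) :=
  ((Lp.memLp u).integrable_mul (Lp.memLp v)).bdd_mul hc hM

lemma abs_integral_mul_mul_le {c : ℝ → ℝ} {M : ℝ} (hM0 : 0 ≤ M)
    (hM : ∀ᵐ x ∂vol L, |c x| ≤ M) (u v : Lp ℝ 2 (vol L)) :
    |∫ x in Ioo 0 L, c x * (u x * v x)| ≤ M * (‖u‖ * ‖v‖) := by
  have hi : Integrable (fun x => |u x| * |v x|) (vol L) :=
    (Lp.memLp u).abs.integrable_mul (Lp.memLp v).abs
  calc |∫ x in Ioo 0 L, c x * (u x * v x)|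
      ≤ ∫ x in Ioo 0 L, M * (|u x| * |v x|) := by
        rw [← Real.norm_eq_abs]
        refine norm_integral_le_of_norm_le (hi.const_mul M) ?_
        filter_upwards [hM] with x hx
        rw [Real.norm_eq_abs, abs_mul, abs_mul]
        gcongr
    _ ≤ M * (‖u‖ * ‖v‖) := by
        rw [integral_const_mul]
        gcongr
        exact integral_abs_mul_abs_le u v

/-- The trilinear pairing `∫ c(t, x) u(x) v(x) dx` is jointly continuous. -/
lemma continuous_integral_mul_mul {c : ℝ → ℝ → ℝ}
    (hc : Continuous fun p : ℝ × ℝ => c p.1 p.2) {M : ℝ} (hM : ∀ t x, |c t x| ≤ M) :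
    Continuous fun q : ℝ × Lp ℝ 2 (vol L) × Lp ℝ 2 (vol L) =>
      ∫ x in Ioo 0 L, c q.1 x * (q.2.1 x * q.2.2 x) := by
  have hM0 : 0 ≤ M := (abs_nonneg _).trans (hM 0 0)
  have hcs : ∀ t, Continuous (c t) := fun t =>
    hc.comp (f := fun x => (t, x)) (by fun_prop)
  have hmeas : ∀ t, AEStronglyMeasurable (c t) (vol L) := fun t => (hcs t).aestronglyMeasurable
  have hi := fun t => integrable_mul_mul (hmeas t) (Eventually.of_forall (hM t))
  have hsub1 : ∀ (t : ℝ) (u u' v : Lp ℝ 2 (vol L)),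
      ∫ x in Ioo 0 L, c t x * ((u - u' : Lp ℝ 2 (vol L)) x * v x)
        = (∫ x in Ioo 0 L, c t x * (u x * v x)) - ∫ x in Ioo 0 L, c t x * (u' x * v x) := by
    intro t u u' v
    rw [← integral_sub (hi t u v) (hi t u' v)]
    apply integral_congr_ae
    filter_upwards [Lp.coeFn_sub u u'] with x hx
    rw [hx, Pi.sub_apply]
    ring
  have hcomm : ∀ (t : ℝ) (u v : Lp ℝ 2 (vol L)),
      ∫ x in Ioo 0 L, c t x * (u x * v x) = ∫ x in Ioo 0 L, c t x * (v x * u x) := by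
    intro t u v
    simp only [mul_comm]
  have hsub2 : ∀ (t : ℝ) (u v v' : Lp ℝ 2 (vol L)),
      ∫ x in Ioo 0 L, c t x * (u x * (v - v' : Lp ℝ 2 (vol L)) x)
        = (∫ x in Ioo 0 L, c t x * (u x * v x)) - ∫ x in Ioo 0 L, c t x * (u x * v' x) := by
    intro t u v v'
    rw [hcomm, hsub1, hcomm t v u, hcomm t v' u]
  rw [continuous_iff_continuousAt]
  rintro ⟨t₀, u₀, v₀⟩
  have ht : Continuous fun t => ∫ x in Ioo 0 L, c t x * (u₀ x * v₀ x) := by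
    have hint : Integrable (fun x => u₀ x * v₀ x) (vol L) :=
      (Lp.memLp u₀).integrable_mul (Lp.memLp v₀)
    refine continuous_of_dominated (bound := fun x => M * ‖u₀ x * v₀ x‖)
      (fun t => (hi t u₀ v₀).aestronglyMeasurable) (fun t => Eventually.of_forall fun x => ?_)
      (hint.norm.const_mul M) (Eventually.of_forall fun x => ?_)
    · rw [norm_mul]
      gcongr
      exact hM t x
    · exact (hc.comp (f := fun t => (t, x)) (by fun_prop)).mul continuous_const
  rw [ContinuousAt, tendsto_iff_dist_tendsto_zero]
  -- The difference is split by replacing first `u` with `u₀`, then `v` with `v₀`, then `t` with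
  -- `t₀`; each summand bounds one replacement and vanishes at the base point.
  have hbound : Continuous fun q : ℝ × Lp ℝ 2 (vol L) × Lp ℝ 2 (vol L) =>
      M * (‖q.2.1 - u₀‖ * ‖q.2.2‖) + M * (‖u₀‖ * ‖q.2.2 - v₀‖)
        + |(∫ x in Ioo 0 L, c q.1 x * (u₀ x * v₀ x))
            - ∫ x in Ioo 0 L, c t₀ x * (u₀ x * v₀ x)| := by
    have := ht.comp (continuous_fst (X := ℝ) (Y := Lp ℝ 2 (vol L) × Lp ℝ 2 (vol L)))
    simp only [Function.comp_def] at this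
    fun_prop
  have hlim := hbound.tendsto (t₀, u₀, v₀)
  simp only [sub_self, norm_zero, zero_mul, mul_zero, abs_zero, add_zero] at hlim
  refine squeeze_zero (fun _ => dist_nonneg) ?_ hlim
  rintro ⟨t, u, v⟩
  rw [Real.dist_eq]
  have e1 := hsub1 t u u₀ v
  have e2 := hsub2 t u₀ v v₀
  have b1 := abs_integral_mul_mul_le hM0 (Eventually.of_forall (hM t)) (u - u₀) v
  have b2 := abs_integral_mul_mul_le hM0 (Eventually.of_forall (hM t)) u₀ (v - v₀)
  rw [e1] at b1
  rw [e2] at b2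
  refine le_trans ?_ (add_le_add (add_le_add b1 b2) le_rfl)
  refine le_trans (le_of_eq ?_) (abs_add_three _ _ _)
  congr 1
  ring

/-- Integrability in time of `∫ c(t, x) u(t, x) v(t, x) dx`. -/
lemma integrable_integral_mul_mul (hL : 0 < L) (hT : 0 < T) {c : ℝ → ℝ → ℝ}
    (hc : ContinuousOn (fun p : ℝ × ℝ => c p.1 p.2) (Icc 0 T ×ˢ Icc 0 L))
    {u v : ℝ → Lp ℝ 2 (vol L)} (hu : MemLp u 2 (vol T)) (hv : MemLp v 2 (vol T)) :
    (∀ t ∈ Ioo 0 T, Integrable (fun x => c t x * (u t x * v t x)) (vol L)) ∧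
      Integrable (fun t => ∫ x in Ioo 0 L, c t x * (u t x * v t x)) (vol T) := by
  obtain ⟨M, hM⟩ := (isCompact_Icc.prod isCompact_Icc).exists_bound_of_continuousOn hc
  have hcl : ∀ {S : ℝ}, 0 < S → ∀ t, max 0 (min S t) ∈ Icc 0 S := fun hS t =>
    ⟨le_max_left _ _, max_le hS.le (min_le_left _ _)⟩
  have hcl' : ∀ {S t : ℝ}, t ∈ Ioo 0 S → max 0 (min S t) = t := fun ht => by
    rw [min_eq_right ht.2.le, max_eq_right ht.1.le]
  have hM0 : 0 ≤ M := (norm_nonneg _).trans (hM (0, 0) ⟨⟨le_rfl, hT.le⟩, ⟨le_rfl, hL.le⟩⟩)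
  -- Clamping both variables extends the coefficient to a bounded continuous function on the plane,
  -- unchanged on the rectangle.
  set c' : ℝ → ℝ → ℝ := fun t x => c (max 0 (min T t)) (max 0 (min L x)) with hc'
  have hc'c : Continuous fun p : ℝ × ℝ => c' p.1 p.2 :=
    hc.comp_continuous (f := fun p : ℝ × ℝ => (max 0 (min T p.1), max 0 (min L p.2)))
      (by fun_prop) fun p => ⟨hcl hT _, hcl hL _⟩
  have hM' : ∀ t x, |c' t x| ≤ M := fun t x =>
    hM (max 0 (min T t), max 0 (min L x)) ⟨hcl hT _, hcl hL _⟩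
  have hcc : ∀ t ∈ Ioo 0 T, ∀ x ∈ Ioo 0 L, c' t x = c t x := fun t ht x hx => by
    simp only [hc', hcl' ht, hcl' hx]
  constructor
  · intro t ht
    have hs := continuousOn_slice hc (Ioo_subset_Icc_self ht)
    refine integrable_mul_mul (integrable_of_continuousOn hs).aestronglyMeasurable (M := M) ?_ _ _
    filter_upwards [ae_mem_vol] with x hx
    exact hM (t, x) ⟨Ioo_subset_Icc_self ht, Ioo_subset_Icc_self hx⟩
  -- Measurability in time comes from composing the continuous pairing with the measurable
  -- `L²`-valued maps; joint measurability in `(t, x)` is never needed.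
  · have hm : AEStronglyMeasurable (fun t => ∫ x in Ioo 0 L, c' t x * (u t x * v t x)) (vol T) :=
      (continuous_integral_mul_mul hc'c hM').comp_aestronglyMeasurable
        (aestronglyMeasurable_id.prodMk (hu.aestronglyMeasurable.prodMk hv.aestronglyMeasurable))
    have hI : Integrable (fun t => ∫ x in Ioo 0 L, c' t x * (u t x * v t x)) (vol T) := by
      refine Integrable.mono' ((hu.norm.integrable_mul hv.norm).const_mul M) hm ?_
      exact Eventually.of_forall fun t =>
        abs_integral_mul_mul_le hM0 (Eventually.of_forall (hM' t)) _ _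
    refine hI.congr ?_
    filter_upwards [ae_mem_vol] with t ht
    exact setIntegral_congr_fun measurableSet_Ioo fun x hx => by simp only [hcc t ht x hx]

/-- Integrability of a quadratic form with continuous coefficients. -/
lemma integrable_integral_quadratic (hL : 0 < L) (hT : 0 < T) {c₁ c₂ c₃ q : ℝ → ℝ → ℝ}
    (h₁ : ContinuousOn (fun p : ℝ × ℝ => c₁ p.1 p.2) (Icc 0 T ×ˢ Icc 0 L))
    (h₂ : ContinuousOn (fun p : ℝ × ℝ => c₂ p.1 p.2) (Icc 0 T ×ˢ Icc 0 L))
    (h₃ : ContinuousOn (fun p : ℝ × ℝ => c₃ p.1 p.2) (Icc 0 T ×ˢ Icc 0 L))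
    {u v : ℝ → Lp ℝ 2 (vol L)} (hu : MemLp u 2 (vol T)) (hv : MemLp v 2 (vol T))
    (hq : ∀ᵐ t ∂vol T, q t = fun x => c₁ t x * (u t x * u t x) + c₂ t x * (u t x * v t x)
      + c₃ t x * (v t x * v t x)) :
    (∀ᵐ t ∂vol T, Integrable (q t) (vol L)) ∧
      Integrable (fun t => ∫ x in Ioo 0 L, q t x) (vol T) := by
  obtain ⟨a₁, b₁⟩ := integrable_integral_mul_mul hL hT h₁ hu hu
  obtain ⟨a₂, b₂⟩ := integrable_integral_mul_mul hL hT h₂ hu hv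
  obtain ⟨a₃, b₃⟩ := integrable_integral_mul_mul hL hT h₃ hv hv
  constructor
  · filter_upwards [hq, ae_mem_vol] with t ht hm
    rw [ht]
    exact ((a₁ t hm).add (a₂ t hm)).add (a₃ t hm)
  · refine ((b₁.add b₂).add b₃).congr ?_
    filter_upwards [hq, ae_mem_vol] with t ht hm
    rw [ht]
    exact ((integral_add ((a₁ t hm).add (a₂ t hm)) (a₃ t hm)).trans
      (congrArg (· + _) (integral_add (a₁ t hm) (a₂ t hm)))).symm

end Quadratic

/-- The highest derivative as a square-integrable function of time with values in `L²`. -/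
lemma MemLpH.exists_memLp {L T : ℝ} {k : ℕ} {f : ℝ → ℝ → ℝ} (hf : MemLpH L T 2 k f) :
    ∃ u : ℝ → Lp ℝ 2 (vol L), MemLp u 2 (vol T) ∧ ∀ᵐ t ∂vol T, D L k (f t) = u t := by
  obtain ⟨U, hU, hrep⟩ := hf
  refine ⟨fun t => (U t).1 (Fin.last k), ?_, hrep.mono fun t ht => D_eq _ _ ht⟩
  have hcont : Continuous fun w : H L k => w.1 (Fin.last k) := by fun_prop
  refine hU.of_le (hcont.comp_aestronglyMeasurable hU.aestronglyMeasurable) ?_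
  exact Eventually.of_forall fun t => PiLp.norm_apply_le (U t).1 (Fin.last k)

/-- The density of the dissipation. -/
noncomputable def density (L R μ ε : ℝ) (f g : ℝ → ℝ → ℝ) (t x : ℝ) : ℝ :=
  a ε (f t x) * (a ε (f t x) * D L 3 (f t) x
      + R / 2 * (2 * a ε (f t x) + 3 * a ε (g t x)) * (D L 3 (f t) x + D L 3 (g t) x)) ^ 2
    + μ * R ^ 2 * (a ε (g t x) ^ 3 * (D L 3 (f t) x + D L 3 (g t) x) ^ 2)
    + 3 * R ^ 2 / 4 * (a ε (f t x) * a ε (g t x) ^ 2 * (D L 3 (f t) x + D L 3 (g t) x) ^ 2)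

lemma a_pos {ε : ℝ} (hε : 0 < ε) (s : ℝ) : 0 < a ε s := by
  unfold a
  positivity

lemma density_nonneg {L R μ ε : ℝ} (hμ : 0 < μ) (hε : 0 < ε) (f g : ℝ → ℝ → ℝ)
    (t x : ℝ) : 0 ≤ density L R μ ε f g t x := by
  have h1 := a_pos hε (f t x)
  have h2 := a_pos hε (g t x)
  unfold density
  positivity

/-- The dissipation is the integral of its density, and it is integrable in time. -/
lemma dissipation_properties {L T R μ ε : ℝ} (hL : 0 < L) (hT : 0 < T) {f g : ℝ → ℝ → ℝ}
    (hf : ContinuousOn (fun p : ℝ × ℝ => f p.1 p.2) (Icc 0 T ×ˢ Icc 0 L))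
    (hg : ContinuousOn (fun p : ℝ × ℝ => g p.1 p.2) (Icc 0 T ×ˢ Icc 0 L))
    (hf3 : MemLpH L T 2 3 f) (hg3 : MemLpH L T 2 3 g) :
    (∀ᵐ t ∂vol T, Integrable (density L R μ ε f g t) (vol L) ∧
      ∫ x in Ioo 0 L, density L R μ ε f g t x = dissipation L R μ ε f g t) ∧
    Integrable (dissipation L R μ ε f g) (vol T) := by
  obtain ⟨u, hu, hfu⟩ := hf3.exists_memLp
  obtain ⟨v, hv, hgv⟩ := hg3.exists_memLp
  have hac : Continuous (a ε) := by
    unfold a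
    fun_prop
  have haf := hac.comp_continuousOn hf
  have hag := hac.comp_continuousOn hg
  simp only [Function.comp_def] at haf hag
  -- Here and below, `c₁, c₂, c₃` are the coefficients of `u²`, `uv`, `v²` after expanding the
  -- square, `u` and `v` being the third derivatives.
  obtain ⟨a₁, b₁⟩ := integrable_integral_quadratic hL hT (u := u) (v := v)
    (c₁ := fun t x => a ε (f t x)
      * (a ε (f t x) + R / 2 * (2 * a ε (f t x) + 3 * a ε (g t x))) ^ 2)
    (c₂ := fun t x => 2 * a ε (f t x)
      * (a ε (f t x) + R / 2 * (2 * a ε (f t x) + 3 * a ε (g t x)))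
      * (R / 2 * (2 * a ε (f t x) + 3 * a ε (g t x))))
    (c₃ := fun t x => a ε (f t x) * (R / 2 * (2 * a ε (f t x) + 3 * a ε (g t x))) ^ 2)
    (q := fun t x => a ε (f t x) * (a ε (f t x) * D L 3 (f t) x
      + R / 2 * (2 * a ε (f t x) + 3 * a ε (g t x)) * (D L 3 (f t) x + D L 3 (g t) x)) ^ 2)
    (by fun_prop) (by fun_prop) (by fun_prop) hu hv (by
      filter_upwards [hfu, hgv] with t h1 h2
      ext x
      rw [h1, h2]
      ring)
  obtain ⟨a₂, b₂⟩ := integrable_integral_quadratic hL hT (u := u) (v := v)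
    (c₁ := fun t x => a ε (g t x) ^ 3) (c₂ := fun t x => 2 * a ε (g t x) ^ 3)
    (c₃ := fun t x => a ε (g t x) ^ 3)
    (q := fun t x => a ε (g t x) ^ 3 * (D L 3 (f t) x + D L 3 (g t) x) ^ 2)
    (by fun_prop) (by fun_prop) (by fun_prop) hu hv (by
      filter_upwards [hfu, hgv] with t h1 h2
      ext x
      rw [h1, h2]
      ring)
  obtain ⟨a₃, b₃⟩ := integrable_integral_quadratic hL hT (u := u) (v := v)
    (c₁ := fun t x => a ε (f t x) * a ε (g t x) ^ 2)
    (c₂ := fun t x => 2 * (a ε (f t x) * a ε (g t x) ^ 2))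
    (c₃ := fun t x => a ε (f t x) * a ε (g t x) ^ 2)
    (q := fun t x => a ε (f t x) * a ε (g t x) ^ 2 * (D L 3 (f t) x + D L 3 (g t) x) ^ 2)
    (by fun_prop) (by fun_prop) (by fun_prop) hu hv (by
      filter_upwards [hfu, hgv] with t h1 h2
      ext x
      rw [h1, h2]
      ring)
  constructor
  · filter_upwards [a₁, a₂, a₃] with t h1 h2 h3
    have h12 := h1.add (h2.const_mul (μ * R ^ 2))
    have h3' := h3.const_mul (3 * R ^ 2 / 4)
    refine ⟨h12.add h3', ?_⟩
    unfold density dissipation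
    rw [← integral_const_mul (μ * R ^ 2), ← integral_const_mul (3 * R ^ 2 / 4)]
    exact (integral_add h12 h3').trans
      (congrArg (· + _) (integral_add h1 (h2.const_mul (μ * R ^ 2))))
  · exact (b₁.add (b₂.const_mul _)).add (b₃.const_mul _)

lemma dissipation_nonneg {L R μ ε : ℝ} (hμ : 0 < μ) (hε : 0 < ε) (f g : ℝ → ℝ → ℝ) (t : ℝ) :
    0 ≤ dissipation L R μ ε f g t := by
  unfold dissipation
  have h1 := fun x => a_pos hε (f t x)
  have h2 := fun x => a_pos hε (g t x)
  refine add_nonneg (add_nonneg ?_ (mul_nonneg (by positivity) ?_))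
    (mul_nonneg (by positivity) ?_) <;>
  · refine integral_nonneg fun x => ?_
    have := h1 x
    have := h2 x
    positivity

/-! ### Pointwise bounds of the fluxes by the dissipation density. -/

lemma a_le {ε η s : ℝ} (hη : 0 ≤ η) (hs : s ≤ η) : a ε s ≤ ε + η := by
  unfold a
  gcongr
  exact max_le hη hs

/-- The first flux is small where `f` is. -/
lemma fluxF_sq_le {L R μ ε η : ℝ} (hμ : 0 < μ) (hε : 0 < ε) (hη : 0 ≤ η)
    {f g : ℝ → ℝ → ℝ} {t x : ℝ} (h : f t x ≤ η) :
    fluxF L R ε f g t x ^ 2 ≤ (ε + η) ^ 3 * density L R μ ε f g t x := by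
  have hf := a_pos hε (f t x)
  have hg := a_pos hε (g t x)
  have hle := a_le (ε := ε) hη h
  unfold fluxF density
  generalize a ε (f t x) = b at *
  generalize a ε (g t x) = c at *
  generalize D L 3 (f t) x = F
  generalize D L 3 (g t) x = G
  set Y := b * F + R / 2 * (2 * b + 3 * c) * (F + G) with hY
  -- The flux is `b²` times the quantity squared in the first dissipation term `b Y²`, which leaves
  -- a factor `b³` after squaring.
  have e : b ^ 3 * F + R / 2 * (2 * b ^ 3 + 3 * b ^ 2 * c) * (F + G) = b ^ 2 * Y := by
    rw [hY]
    ring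
  rw [e]
  calc (b ^ 2 * Y) ^ 2 = b ^ 3 * (b * Y ^ 2) := by ring
    _ ≤ (ε + η) ^ 3 * (b * Y ^ 2) := by gcongr
    _ ≤ _ := by
      gcongr
      have : 0 ≤ μ * R ^ 2 * (c ^ 3 * (F + G) ^ 2) := by positivity
      have : 0 ≤ 3 * R ^ 2 / 4 * (b * c ^ 2 * (F + G) ^ 2) := by positivity
      linarith

/-- The second flux is small where `g` is. -/
lemma fluxG_sq_le {L R μ ε η A : ℝ} (hμ : 0 < μ) (hε : 0 < ε) (hη : 0 ≤ η) (h2 : ε + η ≤ 2)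
    {f g : ℝ → ℝ → ℝ} {t x : ℝ} (h : g t x ≤ η) (hA : a ε (f t x) ≤ A) :
    fluxG L R μ ε f g t x ^ 2
      ≤ (ε + η) ^ 2 * (9 * A + 6 * μ) * density L R μ ε f g t x := by
  have hf := a_pos hε (f t x)
  have hg := a_pos hε (g t x)
  have hle := a_le (ε := ε) hη h
  unfold fluxG density
  generalize a ε (f t x) = b at *
  generalize a ε (g t x) = c at *
  generalize D L 3 (f t) x = F
  generalize D L 3 (g t) x = G
  set Y := b * F + R / 2 * (2 * b + 3 * c) * (F + G) with hY
  set q := F + G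
  -- One summand for each dissipation term: `b Y²`, `c³ q²` and `b c² q²`. Every quotient of a
  -- squared summand by its term contains `c²`.
  have e : 3 / 2 * b ^ 2 * c * F
      + R / 2 * (2 * μ * c ^ 3 + 3 * b ^ 2 * c + 6 * b * c ^ 2) * q
      = 3 / 2 * b * c * Y + μ * R * c ^ 3 * q + 3 / 4 * R * b * c ^ 2 * q := by
    rw [hY]
    ring
  rw [e]
  have hA0 : 0 < A := hf.trans_le hA
  have hs : ∀ x y z : ℝ, (x + y + z) ^ 2 ≤ 3 * (x ^ 2 + y ^ 2 + z ^ 2) := fun x y z => by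
    nlinarith [sq_nonneg (x - y), sq_nonneg (y - z), sq_nonneg (x - z)]
  refine (hs _ _ _).trans ?_
  have hc2 : c ^ 2 ≤ (ε + η) ^ 2 := by gcongr
  -- The three quotients, including the factor `3` from squaring a sum of three. The part `9A`
  -- absorbs those with `b ≤ A`; the part `6μ` absorbs `3μc³`, where `c ≤ ε + η ≤ 2`.
  have k1 : 27 / 4 * (b * c ^ 2) ≤ (ε + η) ^ 2 * (9 * A + 6 * μ) := by
    have : b * c ^ 2 ≤ A * (ε + η) ^ 2 := by gcongr
    nlinarith [sq_nonneg (ε + η), mul_nonneg (sq_nonneg (ε + η)) hμ.le,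
      mul_nonneg (sq_nonneg (ε + η)) hA0.le]
  have k2 : 3 * μ * c ^ 3 ≤ (ε + η) ^ 2 * (9 * A + 6 * μ) := by
    have : c ^ 3 ≤ (ε + η) ^ 2 * 2 := by
      calc c ^ 3 = c ^ 2 * c := by ring
        _ ≤ (ε + η) ^ 2 * 2 := by
          gcongr
          linarith
    have := mul_le_mul_of_nonneg_left this hμ.le
    nlinarith [mul_nonneg (sq_nonneg (ε + η)) hA0.le]
  have k3 : 9 / 4 * (b * c ^ 2) ≤ (ε + η) ^ 2 * (9 * A + 6 * μ) := by
    have : 0 ≤ b * c ^ 2 := by positivity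
    linarith
  have m1 := mul_le_mul_of_nonneg_right k1 (show 0 ≤ b * Y ^ 2 by positivity)
  have m2 := mul_le_mul_of_nonneg_right k2 (show 0 ≤ μ * R ^ 2 * (c ^ 3 * q ^ 2) by positivity)
  have m3 := mul_le_mul_of_nonneg_right k3
    (show 0 ≤ 3 * R ^ 2 / 4 * (b * c ^ 2 * q ^ 2) by positivity)
  calc 3 * ((3 / 2 * b * c * Y) ^ 2 + (μ * R * c ^ 3 * q) ^ 2 + (3 / 4 * R * b * c ^ 2 * q) ^ 2)
      = 27 / 4 * (b * c ^ 2) * (b * Y ^ 2) + 3 * μ * c ^ 3 * (μ * R ^ 2 * (c ^ 3 * q ^ 2))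
        + 9 / 4 * (b * c ^ 2) * (3 * R ^ 2 / 4 * (b * c ^ 2 * q ^ 2)) := by ring
    _ ≤ _ := by linarith

/-! ### Bounds from mass and energy. -/

/-- Functions with mean `m / L` are bounded by the `L²` norm of their derivative. -/
lemma le_of_integral_sq_le {L M m : ℝ} (hL : 0 < L) (hM : 0 ≤ M) {u : H L 1} {w : ℝ → ℝ}
    (h : Represents u w) (hw : ContinuousOn w (Icc 0 L))
    (hu : ∫ x in Ioo 0 L, u.1 1 x ^ 2 ≤ M ^ 2) (hm : ∫ x in Ioo 0 L, w x = m) :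
    ∀ x ∈ Icc 0 L, w x ≤ m / L + √L * M := by
  have hW := h.eq_add_integral hL hw
  have hi : Integrable (u.1 1) (vol L) := (Lp.memLp (u.1 1)).integrable (by norm_num)
  have hii := intervalIntegrable_of_integrable_vol hL hi
  have hcs : ∫ s in Ioo 0 L, |u.1 1 s| ≤ √L * M := by
    have := (integral_sqrt_mul_abs_le (ν := vol L) (p := fun _ => 1) (integrable_const _)
      (Eventually.of_forall fun _ => zero_le_one) (Lp.memLp (u.1 1))).2
    simp only [Real.sqrt_one, one_mul, integral_const, smul_eq_mul, mul_one] at this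
    rw [measureReal_restrict_apply_univ, Real.volume_real_Ioo_of_le hL.le, sub_zero] at this
    refine this.trans ?_
    gcongr
    rw [← Real.sqrt_sq hM]
    exact Real.sqrt_le_sqrt hu
  have hdiff : ∀ x ∈ Icc 0 L, ∀ y ∈ Icc 0 L, w x - w y ≤ √L * M := by
    intro x hx y hy
    have hsub : ∀ z ∈ Icc 0 L, IntervalIntegrable (u.1 1) volume 0 z := fun z hz =>
      hii.mono_set (by rw [uIcc_of_le hz.1, uIcc_of_le hL.le]; exact Icc_subset_Icc_right hz.2)
    rw [hW x hx, hW y hy, add_sub_add_left_eq_sub,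
      intervalIntegral.integral_interval_sub_left (hsub x hx) (hsub y hy)]
    refine le_trans ?_ hcs
    refine (Real.le_norm_self _).trans
      (intervalIntegral.norm_integral_le_integral_norm_uIoc.trans ?_)
    rw [← integral_Ioc_eq_integral_Ioo]
    refine setIntegral_mono_set ?_ (Eventually.of_forall fun _ => norm_nonneg _) ?_
    · exact ((intervalIntegrable_iff_integrableOn_Ioc_of_le hL.le).1 hii).norm
    · refine LE.le.eventuallyLE ?_
      exact Ioc_subset_Ioc (le_min hy.1 hx.1) (max_le hy.2 hx.2)
  intro x hx
  -- Averaging the oscillation bound over `y` replaces `w y` by the mean `m / L`.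
  have hint : ∫ y in Ioo 0 L, w x ≤ ∫ y in Ioo 0 L, (w y + √L * M) := by
    refine setIntegral_mono_on (integrable_const _)
      ((integrable_of_continuousOn hw).add (integrable_const _)) measurableSet_Ioo fun y hy => ?_
    linarith [hdiff x hx y (Ioo_subset_Icc_self hy)]
  rw [integral_add (integrable_of_continuousOn hw) (integrable_const _), hm] at hint
  simp only [integral_const, smul_eq_mul] at hint
  rw [measureReal_restrict_apply_univ, Real.volume_real_Ioo_of_le hL.le, sub_zero] at hint
  have : w x = L * w x / L := by field_simp
  rw [this, show m / L + √L * M = (m + L * (√L * M)) / L by field_simp]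
  gcongr

/-- The energy controls the `L²` norms of the first derivatives. -/
lemma integral_sq_le_of_energy_le {L R E : ℝ} (hR : 0 < R) {u v : H L 1} {w z : ℝ → ℝ}
    (hu : Represents u w) (hv : Represents v z) (hE : energy L R w z ≤ E) :
    ∫ x in Ioo 0 L, u.1 1 x ^ 2 ≤ 4 * E / R + 4 * E ∧
      ∫ x in Ioo 0 L, v.1 1 x ^ 2 ≤ 4 * E / R + 4 * E := by
  unfold energy at hE
  rw [D_eq u w hu, D_eq v z hv] at hE
  have hl : Fin.last 1 = 1 := rfl
  rw [hl] at hE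
  have iu := (Lp.memLp (u.1 1)).integrable_sq
  have iv := (Lp.memLp (v.1 1)).integrable_sq
  have is := ((Lp.memLp (u.1 1)).add (Lp.memLp (v.1 1))).integrable_sq
  simp only [Pi.add_apply] at is
  rw [integral_add iu (is.const_mul R), integral_const_mul] at hE
  have n1 : 0 ≤ ∫ x in Ioo 0 L, u.1 1 x ^ 2 := integral_nonneg fun x => sq_nonneg _
  have n2 : 0 ≤ ∫ x in Ioo 0 L, (u.1 1 x + v.1 1 x) ^ 2 := integral_nonneg fun x => sq_nonneg _
  have hv2 : ∫ x in Ioo 0 L, v.1 1 x ^ 2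
      ≤ 2 * (∫ x in Ioo 0 L, (u.1 1 x + v.1 1 x) ^ 2) + 2 * ∫ x in Ioo 0 L, u.1 1 x ^ 2 := by
    rw [← integral_const_mul, ← integral_const_mul,
      ← integral_add (is.const_mul 2) (iu.const_mul 2)]
    refine integral_mono iv ((is.const_mul 2).add (iu.const_mul 2)) fun x => ?_
    simp only
    -- `2(u+v)² + 2u² - v² = (2u+v)²`.
    nlinarith [sq_nonneg (2 * u.1 1 x + v.1 1 x)]
  have hRn : R * (∫ x in Ioo 0 L, (u.1 1 x + v.1 1 x) ^ 2) ≤ 2 * E := by linarith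
  have hE0 : 0 ≤ E := by nlinarith [mul_nonneg hR.le n2]
  have hs : ∫ x in Ioo 0 L, (u.1 1 x + v.1 1 x) ^ 2 ≤ 2 * E / R := by
    rw [le_div_iff₀ hR]
    linarith
  have hd : 0 ≤ 4 * E / R := by positivity
  have e : 4 * E / R = 2 * (2 * E / R) := by ring
  constructor
  · nlinarith [mul_nonneg hR.le n2]
  · nlinarith [mul_nonneg hR.le n2]

lemma energy_nonneg {L R : ℝ} (hR : 0 < R) (w z : ℝ → ℝ) : 0 ≤ energy L R w z := by
  unfold energy
  have : 0 ≤ ∫ x in Ioo 0 L, (D L 1 w x ^ 2 + R * (D L 1 w x + D L 1 z x) ^ 2) :=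
    integral_nonneg fun x => by positivity
  positivity

namespace IsRegularizedSolution

variable {L R μ ε : ℝ} {f₀ g₀ : ℝ → ℝ} {f g : ℝ → ℝ → ℝ}

lemma continuousOn_fst (hs : IsRegularizedSolution L R μ ε f₀ g₀ f g) {T : ℝ} (hT : 0 < T) :
    ContinuousOn (fun p : ℝ × ℝ => f p.1 p.2) (Icc 0 T ×ˢ Icc 0 L) :=
  (hs.regular_f.holder T hT 0 le_rfl (by norm_num)).continuousOn

lemma continuousOn_snd (hs : IsRegularizedSolution L R μ ε f₀ g₀ f g) {T : ℝ} (hT : 0 < T) :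
    ContinuousOn (fun p : ℝ × ℝ => g p.1 p.2) (Icc 0 T ×ˢ Icc 0 L) :=
  (hs.regular_g.holder T hT 0 le_rfl (by norm_num)).continuousOn

/-- The `H^1` bounds which follow from the energy inequality. -/
lemma ae_deriv_bound (hs : IsRegularizedSolution L R μ ε f₀ g₀ f g) (hR : 0 < R) (hμ : 0 < μ)
    (hε : 0 < ε) {T : ℝ} (hT : 0 < T) :
    ∀ᵐ t ∂vol T, (∃ u : H L 1, Represents u (f t) ∧ ∫ x in Ioo 0 L, u.1 1 x ^ 2
        ≤ 4 * energy L R f₀ g₀ / R + 4 * energy L R f₀ g₀) ∧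
      ∃ v : H L 1, Represents v (g t) ∧ ∫ x in Ioo 0 L, v.1 1 x ^ 2
        ≤ 4 * energy L R f₀ g₀ / R + 4 * energy L R f₀ g₀ := by
  obtain ⟨U, -, hU⟩ := hs.regular_f.memLinfty T hT
  obtain ⟨V, -, hV⟩ := hs.regular_g.memLinfty T hT
  have he := ae_restrict_of_ae_restrict_of_subset
    (show Ioo 0 T ⊆ Ioi 0 from Ioo_subset_Ioi_self) hs.energy_le
  filter_upwards [hU, hV, he] with t h1 h2 h3
  have hn : 0 ≤ ∫ s in Ioo 0 t, dissipation L R μ ε f g s :=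
    integral_nonneg fun s => dissipation_nonneg hμ hε f g s
  obtain ⟨b1, b2⟩ := integral_sq_le_of_energy_le hR h1 h2 (by linarith)
  exact ⟨⟨_, h1, b1⟩, ⟨_, h2, b2⟩⟩

/-- The total dissipation is bounded by the initial energy. -/
lemma integral_dissipation_le (hs : IsRegularizedSolution L R μ ε f₀ g₀ f g) (hL : 0 < L)
    (hR : 0 < R) (hμ : 0 < μ) (hε : 0 < ε) {T : ℝ} (hT : 0 < T) :
    ∫ t in Ioo 0 T, dissipation L R μ ε f g t ≤ energy L R f₀ g₀ := by
  -- The energy inequality holds only at almost every time, so it is used at some `T' > T`; the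
  -- dissipation is non-negative, hence its integral up to `T` is no larger.
  have hex : ∃ T' ∈ Ioo T (T + 1), energy L R (f T') (g T')
      + ∫ t in Ioo 0 T', dissipation L R μ ε f g t ≤ energy L R f₀ g₀ := by
    have he := ae_restrict_of_ae_restrict_of_subset
      (show Ioo T (T + 1) ⊆ Ioi 0 from fun x hx => hT.trans hx.1) hs.energy_le
    have : (ae (volume.restrict (Ioo T (T + 1)))).NeBot := by
      rw [ae_neBot, Ne, Measure.restrict_eq_zero]
      simp
    obtain ⟨T', h1, h2⟩ := (he.and (ae_restrict_mem measurableSet_Ioo)).exists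
    exact ⟨T', h2, h1⟩
  obtain ⟨T', hT', h⟩ := hex
  have hT'0 : 0 < T' := hT.trans hT'.1
  have hI := (dissipation_properties (R := R) (μ := μ) (ε := ε) hL hT'0 (hs.continuousOn_fst hT'0)
    (hs.continuousOn_snd hT'0) (hs.regular_f.memL2 T' hT'0) (hs.regular_g.memL2 T' hT'0)).2
  have hmono : ∫ t in Ioo 0 T, dissipation L R μ ε f g t
      ≤ ∫ t in Ioo 0 T', dissipation L R μ ε f g t :=
    setIntegral_mono_set hI (Eventually.of_forall fun t => dissipation_nonneg hμ hε f g t)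
      (Ioo_subset_Ioo_right hT'.1.le).eventuallyLE
  linarith [energy_nonneg (L := L) hR (f T') (g T')]

/-- The time integral of the square root of the dissipation. -/
lemma integral_sqrt_dissipation_le (hs : IsRegularizedSolution L R μ ε f₀ g₀ f g) (hL : 0 < L)
    (hR : 0 < R) (hμ : 0 < μ) (hε : 0 < ε) {T : ℝ} (hT : 0 < T) :
    Integrable (fun t => √(dissipation L R μ ε f g t)) (vol T) ∧
      ∫ t in Ioo 0 T, √(dissipation L R μ ε f g t) ≤ √(energy L R f₀ g₀) * √T := by
  have hI := (dissipation_properties (R := R) (μ := μ) (ε := ε) hL hT (hs.continuousOn_fst hT)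
    (hs.continuousOn_snd hT) (hs.regular_f.memL2 T hT) (hs.regular_g.memL2 T hT)).2
  obtain ⟨h1, h2⟩ := integral_sqrt_mul_abs_le hI
    (Eventually.of_forall fun t => dissipation_nonneg hμ hε f g t) (memLp_const (1 : ℝ))
  simp only [abs_one, mul_one, one_pow, integral_const, smul_eq_mul] at h1 h2
  rw [measureReal_restrict_apply_univ, Real.volume_real_Ioo_of_le hT.le, sub_zero] at h2
  refine ⟨h1, h2.trans ?_⟩
  gcongr
  exact hs.integral_dissipation_le hL hR hμ hε hT

end IsRegularizedSolution

/-! ### The estimates of the negative parts and passage to the limit. -/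

/-- The integral of `χ_δ` over non-negative data vanishes. -/
lemma integral_chi_eq_zero {L δ : ℝ} {φ : ℝ → ℝ} (hφs : tsupport φ ⊆ Icc (-1) 0) (hδ : 0 < δ)
    {w w₀ : ℝ → ℝ} (hw : w =ᵐ[vol L] w₀) (hw₀ : ∀ᵐ x ∂vol L, 0 ≤ w₀ x) :
    ∫ x in Ioo 0 L, chi φ δ (w x) = 0 := by
  apply integral_eq_zero_of_ae
  filter_upwards [hw, hw₀] with x h1 h2
  exact chi_eq_zero hφs hδ (by rw [h1]; exact h2)

/-- The estimate of the negative part of a component whose flux obeys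
`J² ≤ κ(η)² p` where the component is at most `η`. -/
lemma integral_chi_le_of_flux_le {L T R μ ε : ℝ} (hL : 0 < L) (hT : 0 < T) (hR : 0 < R)
    (hμ : 0 < μ) (hε : 0 < ε) {φ : ℝ → ℝ} (hφ : Continuous φ) (hφ0 : ∀ x, 0 ≤ φ x)
    (hφs : tsupport φ ⊆ Icc (-1) 0) {K : ℝ} (hK : ∀ x, φ x ≤ K) {δ : ℝ} (hδ : 0 < δ)
    {f₀ g₀ h₀ : ℝ → ℝ} {f g h J : ℝ → ℝ → ℝ}
    (hs : IsRegularizedSolution L R μ ε f₀ g₀ f g)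
    (hh : ContinuousOn (fun p : ℝ × ℝ => h p.1 p.2) (Icc 0 T ×ˢ Icc 0 L))
    (hw : WeakEquation L T h J) (h0 : h 0 =ᵐ[vol L] h₀) (hh₀ : ∀ᵐ x ∂vol L, 0 ≤ h₀ x)
    {M : ℝ} (hM : 0 ≤ M) (hu : ∀ᵐ t ∂vol T, ∃ u : H L 1, Represents u (h t) ∧
      ∫ x in Ioo 0 L, u.1 1 x ^ 2 ≤ M ^ 2)
    {κ : ℝ → ℝ} (hκc : Continuous κ) (hκ : ∀ η, 0 < η → 0 ≤ κ η)
    (hJ : ∀ η, 0 < η → η ≤ 1 → ∀ᵐ t ∂vol T, ∀ x ∈ Ioo 0 L, h t x ≤ η →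
      J t x ^ 2 ≤ κ η ^ 2 * density L R μ ε f g t x) :
    |∫ x in Ioo 0 L, chi φ δ (h T x)|
      ≤ κ 0 * (K / δ) * M * (√(energy L R f₀ g₀) * √T) := by
  have hK0 : 0 ≤ K := (hφ0 0).trans (hK 0)
  rw [abs_of_nonneg (integral_nonneg fun x => chi_nonneg hφ hφ0 hφs hδ _)]
  obtain ⟨hPi, hPle⟩ := hs.integral_sqrt_dissipation_le hL hR hμ hε hT
  have hd := (dissipation_properties (R := R) (μ := μ) (ε := ε) hL hT (hs.continuousOn_fst hT)
    (hs.continuousOn_snd hT) (hs.regular_f.memL2 T hT) (hs.regular_g.memL2 T hT)).1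
  have hη : ∀ η, 0 < η → η ≤ 1 → ∫ x in Ioo 0 L, chi φ δ (h T x)
      ≤ κ η * (K / δ) * M * (√(energy L R f₀ g₀) * √T) := by
    intro η hη hη1
    have := integral_chi_final_sub_le hL hT hφ hφ0 hφs hK hδ hh hw (hκ η hη) hM hη
      (p := density L R μ ε f g) (P := dissipation L R μ ε f g) (by
        filter_upwards [hd, hJ η hη hη1] with t h1 h2
        exact ⟨h1.1, h1.2, fun x hx => ⟨density_nonneg hμ hε f g t x, h2 x hx⟩⟩) hPi hu
    rw [integral_chi_eq_zero hφs hδ h0 hh₀, sub_zero] at this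
    refine this.trans ?_
    have := hκ η hη
    gcongr
  -- The left-hand side does not depend on `η`, so the tolerance from freezing the test function can
  -- be sent to zero.
  have hlim : Tendsto (fun η => κ η * (K / δ) * M * (√(energy L R f₀ g₀) * √T)) (𝓝[>] 0)
      (𝓝 (κ 0 * (K / δ) * M * (√(energy L R f₀ g₀) * √T))) := by
    have : Continuous fun η => κ η * (K / δ) * M * (√(energy L R f₀ g₀) * √T) := by fun_prop
    exact (this.tendsto 0).mono_left nhdsWithin_le_nhds
  refine ge_of_tendsto hlim ?_
  filter_upwards [Ioc_mem_nhdsGT zero_lt_one] with η hη' using hη η hη'.1 hη'.2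

/-- The uniform estimates of the negative parts. -/
lemma exists_integral_chi_bound {L R μ : ℝ} (hL : 0 < L) (hR : 0 < R) (hμ : 0 < μ)
    {φ : ℝ → ℝ} (hφ : Continuous φ) (hφ0 : ∀ x, 0 ≤ φ x) (hφs : tsupport φ ⊆ Icc (-1) 0)
    {f₀ g₀ : ℝ → ℝ} (hf₀0 : ∀ᵐ x ∂vol L, 0 ≤ f₀ x) (hg₀0 : ∀ᵐ x ∂vol L, 0 ≤ g₀ x) :
    ∃ C : ℝ, ∀ ε : ℝ, 0 < ε → ε ≤ 1 → ∀ f g : ℝ → ℝ → ℝ,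
      IsRegularizedSolution L R μ ε f₀ g₀ f g → ∀ T : ℝ, 0 ≤ T →
        |∫ x in Ioo 0 L, chi φ (√ε) (f T x)| ≤ C * √T * ε ∧
        |∫ x in Ioo 0 L, chi φ (√ε) (g T x)| ≤ C * √(T * ε) := by
  obtain ⟨K, hK⟩ := HasCompactSupport.exists_bound_of_continuous
    (isCompact_Icc.of_isClosed_subset (isClosed_tsupport φ) hφs) hφ
  have hK' : ∀ x, φ x ≤ K := fun x => (Real.le_norm_self _).trans (hK x)
  have hK0 : 0 ≤ K := (hφ0 0).trans (hK' 0)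
  set E := energy L R f₀ g₀ with hE
  have hE0 : 0 ≤ E := energy_nonneg hR f₀ g₀
  set M := √(4 * E / R + 4 * E) with hM
  have hM0 : 0 ≤ M := Real.sqrt_nonneg _
  have hM2 : M ^ 2 = 4 * E / R + 4 * E := Real.sq_sqrt (by positivity)
  set m := ∫ x in Ioo 0 L, |f₀ x| with hm
  have hm0 : 0 ≤ m := integral_nonneg fun x => abs_nonneg _
  -- `A` bounds `a_ε(f)`: the `1` covers `ε ≤ 1`, the bracket is the sup bound on `f` from its mass
  -- and the energy.
  set A := 1 + (m / L + √L * M) with hA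
  have hA0 : 0 ≤ A := by positivity
  set B := √(9 * A + 6 * μ) with hB
  have hB0 : 0 ≤ B := Real.sqrt_nonneg _
  have hB2 : B ^ 2 = 9 * A + 6 * μ := Real.sq_sqrt (by positivity)
  refine ⟨K * M * √E * (1 + B), ?_⟩
  intro ε hε hε1 f g hs T hT
  have hδ : 0 < √ε := Real.sqrt_pos.2 hε
  have hδ2 : √ε * √ε = ε := Real.mul_self_sqrt hε.le
  rcases hT.eq_or_lt with rfl | hT
  · rw [integral_chi_eq_zero hφs hδ hs.initial_f hf₀0,
      integral_chi_eq_zero hφs hδ hs.initial_g hg₀0]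
    simp
  have hae := hs.ae_deriv_bound hR hμ hε hT
  rw [← hE, ← hM2] at hae
  have hf := hs.continuousOn_fst hT
  have hg := hs.continuousOn_snd hT
  constructor
  · refine (integral_chi_le_of_flux_le hL hT hR hμ hε hφ hφ0 hφs hK' hδ hs hf
      (hs.equation_f T hT) hs.initial_f hf₀0 hM0 (hae.mono fun t h => h.1)
      (κ := fun η => √((ε + η) ^ 3)) (by fun_prop) (fun η _ => Real.sqrt_nonneg _) ?_).trans ?_
    · intro η hη _
      refine Eventually.of_forall fun t x _ hx => ?_
      rw [Real.sq_sqrt (by positivity)]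
      exact fluxF_sq_le hμ hε hη.le hx
    -- At `η = 0` the flux constant is `ε^{3/2}`; division by `δ = √ε` leaves `ε`.
    · have e : √((ε + 0) ^ 3) = ε * √ε := by
        rw [add_zero, pow_succ, Real.sqrt_mul (by positivity), Real.sqrt_sq hε.le]
      rw [e, ← hE]
      calc ε * √ε * (K / √ε) * M * (√E * √T) = K * M * √E * 1 * √T * ε := by field_simp
        _ ≤ K * M * √E * (1 + B) * √T * ε := by
          gcongr
          linarith
  · refine (integral_chi_le_of_flux_le hL hT hR hμ hε hφ hφ0 hφs hK' hδ hs hg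
      (hs.equation_g T hT) hs.initial_g hg₀0 hM0 (hae.mono fun t h => h.2)
      (κ := fun η => (ε + η) * B) (by fun_prop) (fun η hη => by positivity) ?_).trans ?_
    · intro η hη hη1
      filter_upwards [hae, ae_mem_vol] with t ⟨⟨u, hu, huM⟩, _⟩ ht x hx hgx
      have hbd := le_of_integral_sq_le hL hM0 hu
        (continuousOn_slice hf (Ioo_subset_Icc_self ht)) huM (hs.mass_f t ht.1.le)
        x (Ioo_subset_Icc_self hx)
      rw [mul_pow, hB2]
      refine fluxG_sq_le hμ hε hη.le (by linarith) hgx ?_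
      refine (a_le (η := m / L + √L * M) (by positivity) hbd).trans ?_
      rw [hA]
      gcongr
    · rw [add_zero, ← hE, Real.sqrt_mul hT.le]
      calc ε * B * (K / √ε) * M * (√E * √T) = (√ε * √ε) * B * (K / √ε) * M * (√E * √T) := by
            rw [hδ2]
        _ = K * M * √E * B * (√T * √ε) := by field_simp
        _ ≤ K * M * √E * (1 + B) * (√T * √ε) := by
          gcongr
          linarith

/-- A uniform limit of functions with vanishing `∫ χ_δ` is non-negative. -/
lemma nonneg_of_tendsto_integral_chi {L : ℝ} (hL : 0 < L) {φ : ℝ → ℝ} (hφ : Continuous φ)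
    (hφ0 : ∀ x, 0 ≤ φ x) (hφs : tsupport φ ⊆ Icc (-1) 0) (hφ1 : ∫ x, φ x = 1)
    {δ : ℕ → ℝ} (hδ : ∀ k, 0 < δ k) (hδ0 : Tendsto δ atTop (𝓝 0)) {W : ℕ → ℝ → ℝ} {w : ℝ → ℝ}
    (hW : ∀ k, ContinuousOn (W k) (Icc 0 L)) (hw : ContinuousOn w (Icc 0 L))
    (hlim : TendstoUniformlyOn W w atTop (Icc 0 L))
    (hχ : Tendsto (fun k => ∫ x in Ioo 0 L, chi φ (δ k) (W k x)) atTop (𝓝 0)) :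
    ∀ x ∈ Icc 0 L, 0 ≤ w x := by
  have hc : ContinuousOn (fun x => max (-w x) 0) (Icc 0 L) := hw.neg.sup continuousOn_const
  have hi := integrable_of_continuousOn hc
  have hle : ∫ x in Ioo 0 L, max (-w x) 0 ≤ 0 := by
    refine le_of_forall_pos_le_add fun r hr => ?_
    -- The budget `r` is shared by one error in `∫ χ_δ` and two pointwise errors integrated over
    -- length `L`: the uniform distance and the shift `δ`.
    have hrL : 0 < r / (1 + 2 * L) := by positivity
    obtain ⟨k, h1, h2, h3⟩ := ((Metric.tendstoUniformlyOn_iff.1 hlim _ hrL).and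
      ((hχ.eventually_lt_const hrL).and (hδ0.eventually_lt_const hrL))).exists
    have hcont : ContinuousOn (fun x => chi φ (δ k) (W k x)) (Icc 0 L) :=
      (continuous_chi hφ hφs (hδ k)).comp_continuousOn (hW k)
    have hci := integrable_of_continuousOn hcont
    calc ∫ x in Ioo 0 L, max (-w x) 0
        ≤ ∫ x in Ioo 0 L, (chi φ (δ k) (W k x) + 2 * (r / (1 + 2 * L))) := by
          refine setIntegral_mono_on hi (hci.add (integrable_const _)) measurableSet_Ioo
            fun x hx => ?_
          have hd := h1 x (Ioo_subset_Icc_self hx)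
          rw [Real.dist_eq, abs_lt] at hd
          have ha := neg_sub_le_chi hφ hφ0 hφs hφ1 (hδ k) (W k x)
          have hb := chi_nonneg hφ hφ0 hφs (hδ k) (W k x)
          refine max_le ?_ ?_ <;> linarith
      _ = (∫ x in Ioo 0 L, chi φ (δ k) (W k x)) + L * (2 * (r / (1 + 2 * L))) := by
          rw [integral_add hci (integrable_const _)]
          simp [Real.volume_real_Ioo_of_le hL.le]
      _ ≤ r / (1 + 2 * L) + L * (2 * (r / (1 + 2 * L))) := by linarith
      _ = 0 + r := by field_simp; ring
  have hz : (fun x => max (-w x) 0) =ᵐ[vol L] fun _ => 0 :=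
    (integral_eq_zero_iff_of_nonneg (fun x => le_max_right _ _) hi).1
      (hle.antisymm (integral_nonneg fun x => le_max_right _ _))
  have hE : EqOn (fun x => max (-w x) 0) (fun _ => 0) (Ioo 0 L) :=
    Measure.eqOn_open_of_ae_eq hz isOpen_Ioo (hc.mono Ioo_subset_Icc_self) continuousOn_const
  have hE' := hE.of_subset_closure hc continuousOn_const Ioo_subset_Icc_self
    (by rw [closure_Ioo hL.ne])
  intro x hx
  have := hE' hx
  simp only at this
  linarith [le_max_left (-w x) 0]

end ThinFilm

theorem lemma2p2 (L R μ : ℝ) (hL : 0 < L) (hR : 0 < R) (hμ : 0 < μ)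
    (φ : ℝ → ℝ) (hφ : ContDiff ℝ ∞ φ) (hφ0 : ∀ x, 0 ≤ φ x)
    (hφs : tsupport φ ⊆ Icc (-1) 0) (hφ1 : ∫ x, φ x = 1)
    (f₀ g₀ : ℝ → ℝ) (hf₀ : ThinFilm.MemH L 1 f₀) (hg₀ : ThinFilm.MemH L 1 g₀)
    (hf₀0 : ∀ᵐ x ∂ThinFilm.vol L, 0 ≤ f₀ x) (hg₀0 : ∀ᵐ x ∂ThinFilm.vol L, 0 ≤ g₀ x) :
    (∃ C : ℝ, ∀ ε : ℝ, 0 < ε → ε ≤ 1 → ∀ f g : ℝ → ℝ → ℝ,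
      ThinFilm.IsRegularizedSolution L R μ ε f₀ g₀ f g → ∀ T : ℝ, 0 ≤ T →
        |∫ x in Ioo 0 L, ThinFilm.chi φ (√ε) (f T x)| ≤ C * √T * ε ∧
        |∫ x in Ioo 0 L, ThinFilm.chi φ (√ε) (g T x)| ≤ C * √(T * ε)) ∧
    (∀ T : ℝ, 0 < T → ∀ ε : ℕ → ℝ, (∀ k, 0 < ε k ∧ ε k ≤ 1) → Tendsto ε atTop (𝓝 0) →
      ∀ F G : ℕ → ℝ → ℝ → ℝ,
      (∀ k, ThinFilm.IsRegularizedSolution L R μ (ε k) f₀ g₀ (F k) (G k)) →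
      ∀ f g : ℝ × ℝ → ℝ,
      ContinuousOn f (Icc 0 T ×ˢ Icc 0 L) → ContinuousOn g (Icc 0 T ×ˢ Icc 0 L) →
      TendstoUniformlyOn (fun k p => F k p.1 p.2) f atTop (Icc 0 T ×ˢ Icc 0 L) →
      TendstoUniformlyOn (fun k p => G k p.1 p.2) g atTop (Icc 0 T ×ˢ Icc 0 L) →
      ∀ p ∈ Icc 0 T ×ˢ Icc 0 L, 0 ≤ f p ∧ 0 ≤ g p) := by
  have hbound := ThinFilm.exists_integral_chi_bound hL hR hμ hφ.continuous hφ0 hφs hf₀0 hg₀0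
  refine ⟨hbound, ?_⟩
  obtain ⟨C, hC⟩ := hbound
  rintro T hT ε hε hε0 F G hs f g hf hg hF hG ⟨t, x⟩ ⟨ht, hx⟩
  have hδ : ∀ k, 0 < √(ε k) := fun k => Real.sqrt_pos.2 (hε k).1
  have hδ0 : Tendsto (fun k => √(ε k)) atTop (𝓝 0) := by
    simpa [Function.comp_def] using (Real.continuous_sqrt.tendsto 0).comp hε0
  have hsub : ∀ y ∈ Icc 0 L, (t, y) ∈ Icc 0 T ×ˢ Icc 0 L := fun y hy => ⟨ht, hy⟩
  have hslice : ∀ {W : ℕ → ℝ → ℝ → ℝ} {w : ℝ × ℝ → ℝ},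
      TendstoUniformlyOn (fun k p => W k p.1 p.2) w atTop (Icc 0 T ×ˢ Icc 0 L) →
      TendstoUniformlyOn (fun k => W k t) (fun y => w (t, y)) atTop (Icc 0 L) := by
    intro W w h
    exact (h.comp (fun y => (t, y))).mono hsub
  constructor
  · refine ThinFilm.nonneg_of_tendsto_integral_chi hL hφ.continuous hφ0 hφs hφ1 hδ hδ0
      (fun k => ThinFilm.continuousOn_slice ((hs k).continuousOn_fst hT) ht)
      (hf.comp (by fun_prop) hsub) (hslice hF) ?_ x hx
    -- The bound of the first part is applied at the fixed time `t`, so non-negativity is obtained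
    -- slice by slice.
    refine squeeze_zero_norm (fun k => (hC _ (hε k).1 (hε k).2 _ _ (hs k) t ht.1).1) ?_
    simpa using hε0.const_mul (C * √t)
  · refine ThinFilm.nonneg_of_tendsto_integral_chi hL hφ.continuous hφ0 hφs hφ1 hδ hδ0
      (fun k => ThinFilm.continuousOn_slice ((hs k).continuousOn_snd hT) ht)
      (hg.comp (by fun_prop) hsub) (hslice hG) ?_ x hx
    refine squeeze_zero_norm (fun k => (hC _ (hε k).1 (hε k).2 _ _ (hs k) t ht.1).2) ?_
    have := (Real.continuous_sqrt.tendsto _).comp (hε0.const_mul t)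
    simpa [Function.comp_def] using this.const_mul C
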